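/- Let $n\ge 1$ and $d\ge 1$. For $\sigma\in\mathcal S_n$ and $x=(x_1,\dots,x_n)\in(\mathbb R^d)^n$ put $\sigma.x=(x_{\sigma(1)},\dots,x_{\sigma(n)})$. A polynomial $p\in\mathbb R[x_1,\dots,x_n]$ (in the $dn$ coordinates of $x$) is totally symmetric if $p(\sigma.x)=p(x)$ for all $\sigma$, and $n$-antisymmetric (an alternant) if $p(\sigma.x)=\operatorname{sgn}(\sigma)\,p(x)$ for all $\sigma$. The alternants form a finitely generated module over the ring of totally symmetric polynomials; let $K$ be its minimal number of generators. (a) There is exactly one pair of integers $r,j\ge 0$ with $n=\binom{r}{d}+j$ and $j<\binom{r}{d-1}$, and for this pair $$\binom{\binom{r}{d-1}}{j}\;\le\; K\;\le\;\binom{\binom n2+dn}{dn}.$$ (b) There are alternants $g_1,\dots,g_K$, each homogeneous of degree at most $\binom n2$, that generate the module of alternants over the totally symmetric polynomials and have the following approximation property (so that $K$ and the $g_i$ depend only on $n$ and $d$). Let $k\ge 0$ be an integer, let $\Omega\subset\mathbb R^d$ be compact, and let $f:(\mathbb R^d)^n\to\mathbb R$ be a function that is $k$ times continuously differentiable on some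 open set containing $\Omega^n$, with $f(\sigma.x)=\operatorname{sgn}(\sigma)f(x)$ for all $x\in\Omega^n$ and $\sigma\in\mathcal S_n$. Then there is a function $F:(\mathbb R^d)^n\to\mathbb R$, also $k$ times continuously differentiable on an open set containing $\Omega^n$, with $F=f$ on $\Omega^n$, such that for every $\varepsilon>0$ there are totally symmetric polynomials $u_1,\dots,u_K$ with $$\Big\|F-\sum_{i=1}^K u_i g_i\Big\|_{\mathcal C^k(\Omega^n)}<\varepsilon,\qquad \|h\|_{\mathcal C^k(\Omega^n)}=\sum_{|\alpha|\le k}\ \max_{x\in\Omega^n}|D^\alpha h(x)|.$$ One can take $F=f$ if $\Omega$ is contained in the closure of its interior, or if $f(\sigma.x)=\operatorname{sgn}(\sigma)f(x)$ holds for all $x$ in some open set containing $\Omega^n$ and all $\sigma\in\mathcal S_n$. -/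

import Mathlib

/-- The polynomial ring `ℝ[x₁, …, xₙ]` with `xᵢ = (xᵢ₁, …, xᵢ_d)`; the variable `(i, j)` is `xᵢⱼ`. -/
abbrev PolyRing (n d : ℕ) : Type := MvPolynomial (Fin n × Fin d) ℝ

/-- `permPoly σ p` is the polynomial `x ↦ p (x_{σ 1}, …, x_{σ n})`. -/
noncomputable def permPoly {n d : ℕ} (σ : Equiv.Perm (Fin n)) : PolyRing n d →ₐ[ℝ] PolyRing n d :=
  MvPolynomial.rename (Prod.map σ id)

/-- The value of a polynomial at a point of `(ℝ^d)^n`. -/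
noncomputable def evalAt {n d : ℕ} (x : Fin n → Fin d → ℝ) (p : PolyRing n d) : ℝ :=
  MvPolynomial.eval (fun v : Fin n × Fin d => x v.1 v.2) p

theorem evalAt_permPoly {n d : ℕ} (σ : Equiv.Perm (Fin n)) (x : Fin n → Fin d → ℝ)
    (p : PolyRing n d) : evalAt x (permPoly σ p) = evalAt (fun i => x (σ i)) p := by
  simp only [evalAt, permPoly, MvPolynomial.eval_rename]
  rfl

/-- The algebra of totally symmetric polynomials. -/
noncomputable def symmetricPolys (n d : ℕ) : Subalgebra ℝ (PolyRing n d) where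
  carrier := {p | ∀ σ : Equiv.Perm (Fin n), permPoly σ p = p}
  mul_mem' := by
    intro a b ha hb σ
    rw [map_mul, ha σ, hb σ]
  add_mem' := by
    intro a b ha hb σ
    rw [map_add, ha σ, hb σ]
  algebraMap_mem' := by
    intro r σ
    exact (permPoly σ).commutes r

/-- The `n`-antisymmetric polynomials (alternants), as a module over the totally symmetric ones:
`p (x_{σ 1}, …, x_{σ n}) = sgn σ · p (x₁, …, xₙ)` for all permutations `σ`. -/
noncomputable def alternants (n d : ℕ) : Submodule (symmetricPolys n d) (PolyRing n d) where
  carrier := {p | ∀ σ : Equiv.Perm (Fin n),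
    permPoly σ p = (((Equiv.Perm.sign σ : ℤˣ) : ℤ) : PolyRing n d) * p}
  add_mem' := by
    intro a b ha hb σ
    rw [map_add, ha σ, hb σ, mul_add]
  zero_mem' := by
    intro σ
    rw [map_zero, mul_zero]
  smul_mem' := by
    intro c p hp σ
    rw [Subalgebra.smul_def, smul_eq_mul, map_mul, c.2 σ, hp σ]
    ring

/-- The set `Ω^n ⊆ (ℝ^d)^n`. -/
def cartesianPower {d : ℕ} (n : ℕ) (Ω : Set (Fin d → ℝ)) : Set (Fin n → Fin d → ℝ) :=
  {x | ∀ i, x i ∈ Ω}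

/-- `f` is `n`-antisymmetric on `S`. -/
def AntisymmetricOn {n d : ℕ} (f : (Fin n → Fin d → ℝ) → ℝ) (S : Set (Fin n → Fin d → ℝ)) :
    Prop :=
  ∀ σ : Equiv.Perm (Fin n), ∀ x ∈ S,
    f (fun i => x (σ i)) = (((Equiv.Perm.sign σ : ℤˣ) : ℤ) : ℝ) * f x

/-- `f` is `C^k` on the compact set `V`: it is `k` times continuously differentiable on an open
set that contains `V`. -/
def IsCkOn {n d : ℕ} (k : ℕ) (V : Set (Fin n → Fin d → ℝ)) (f : (Fin n → Fin d → ℝ) → ℝ) : Prop :=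
  ∃ U : Set (Fin n → Fin d → ℝ), IsOpen U ∧ V ⊆ U ∧ ContDiffOn ℝ k f U

/-- The partial derivative `∂f/∂xᵢⱼ`, where `v = (i, j)`. -/
noncomputable def partialD {n d : ℕ} (v : Fin n × Fin d) (f : (Fin n → Fin d → ℝ) → ℝ) :
    (Fin n → Fin d → ℝ) → ℝ :=
  fun x => lineDeriv ℝ f x (Pi.single v.1 (Pi.single v.2 1))

/-- The partial derivative `D^α f` of multi-index `α`: the operators `∂^{αᵢⱼ}/∂xᵢⱼ^{αᵢⱼ}` composed
in the lexicographic order of the `(i, j)`, the last one being applied first. -/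
noncomputable def multiD {n d : ℕ} (α : Fin n × Fin d → ℕ) (f : (Fin n → Fin d → ℝ) → ℝ) :
    (Fin n → Fin d → ℝ) → ℝ :=
  (List.finRange n ×ˢ List.finRange d).foldr (fun v h => (partialD v)^[α v] h) f

/-- The norm `∑_{|α| ≤ k} max_{x ∈ V} |D^α f (x)|`. -/
noncomputable def ckNorm {n d : ℕ} (k : ℕ) (V : Set (Fin n → Fin d → ℝ))
    (f : (Fin n → Fin d → ℝ) → ℝ) : ℝ :=
  ∑ m ∈ Finset.range (k + 1),
    ∑ α ∈ Finset.piAntidiag (Finset.univ : Finset (Fin n × Fin d)) m,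
      sSup ((fun x => |multiD α f x|) '' V)

/-! Algebra. Let S be the ring of totally symmetric polynomials and A the module of alternants.
Adjoining the points one at a time to S, an affine form in the next point is a root of a monic
polynomial over the algebra built so far, because its n conjugates under permutation have symmetric
elementary functions and the factors of the earlier points can be divided out. The degrees of these
polynomials are n, n - 1, ..., 1, so the polynomial ring is generated over S in degrees at most 0 +
1 + ... + (n - 1) = C(n, 2) (`top_le_symmetricPolys_mul`). Antisymmetrization is S-linear and
multiplies alternants by n!, so the antisymmetrized monomials of these degrees generate A
(`span_slater`); counting monomials gives the upper bound. A graded Nakayama argument on A / S₊A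
extracts a minimal homogeneous system from them.

For the lower bound, a monomial of an alternant has distinct exponents at the n points. The least
possible total degree D is reached by taking all exponents of degree at most s and j of degree s +
1, where r = s + d. Every such choice gives an alternant of degree D, and nothing in S₊A reaches
down to degree D, so these alternants stay independent in A / S₊A (`choose_le_spanFinrank`).

Analysis. Convolution with Landau-type polynomial kernels approximates f by a polynomial p in the
C^k sense. Averaging over signed permutations turns p into an alternant, hence an S-combination of
the generators, and does not increase the error. What gets approximated is the antisymmetric part of
f. It equals f on Ω^n, but its derivatives there may differ from those of f; they agree if Ω lies in
the closure of its interior or if f is antisymmetric near Ω^n. This is why F is needed. -/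

/-! ### Polarization and roots of monic polynomials over a subalgebra -/

section Generation

/-- A real subspace that contains all values of a polynomial with vector coefficients contains its
coefficients. -/
theorem Submodule.mem_of_forall_sum_pow_smul_mem {M : Type*} [AddCommGroup M] [Module ℝ M]
    (W : Submodule ℝ M) (p : ℕ) (w : ℕ → M)
    (h : ∀ t : ℝ, ∑ i ∈ Finset.range p, t ^ i • w i ∈ W) {i : ℕ} (hi : i < p) : w i ∈ W := by
  by_contra hw
  -- A functional that separates `w i` from `W` turns the hypothesis into a real polynomial
  -- vanishing at every `t`.
  obtain ⟨φ, hφ, hW⟩ := Submodule.exists_dual_map_eq_bot_of_notMem hw inferInstance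
  have h0 : ∀ x ∈ W, φ x = 0 := fun x hx => by
    have : φ x ∈ W.map φ := Submodule.mem_map_of_mem hx
    rw [hW] at this
    simpa using this
  let q : Polynomial ℝ := ∑ i ∈ Finset.range p, Polynomial.C (φ (w i)) * Polynomial.X ^ i
  have hq : q = 0 := by
    apply Polynomial.funext
    intro t
    have := h0 _ (h t)
    simp only [map_sum, map_smul, smul_eq_mul] at this
    simp only [q, Polynomial.eval_finsetSum, Polynomial.eval_mul, Polynomial.eval_C,
      Polynomial.eval_pow, Polynomial.eval_X, Polynomial.eval_zero]
    rw [← this]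
    exact Finset.sum_congr rfl fun i _ => mul_comm _ _
  have : q.coeff i = φ (w i) := by
    simp only [q, Polynomial.finsetSum_coeff, Polynomial.coeff_C_mul_X_pow]
    rw [Finset.sum_ite_eq]
    simp [hi]
  rw [hq] at this
  exact hφ this.symm

/-- Polarization: products of `m` elements of `V` are combinations of `m`-th powers. -/
theorem Submodule.pow_le_of_forall_pow_mem {R : Type*} [CommRing R] [Algebra ℝ R]
    (V W : Submodule ℝ R) (m : ℕ) (h : ∀ v ∈ V, v ^ m ∈ W) : V ^ m ≤ W := by
  have key : ∀ j ≤ m, ∀ b ∈ V ^ j, ∀ a ∈ V, b * a ^ (m - j) ∈ W := by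
    intro j
    induction j with
    | zero =>
      intro _ b hb a ha
      rw [pow_zero, Submodule.mem_one] at hb
      obtain ⟨c, rfl⟩ := hb
      rw [← Algebra.smul_def]
      exact W.smul_mem _ (h a ha)
    | succ j ih =>
      intro hj b hb a ha
      rw [pow_succ] at hb
      induction hb using Submodule.mul_induction_on' with
      | add x _ y _ hx hy => rw [add_mul]; exact W.add_mem hx hy
      | mem_mul_mem b hb v hv =>
        obtain ⟨p, hp⟩ : ∃ p, m - j = p + 1 := ⟨m - j - 1, by omega⟩
        have hp' : m - (j + 1) = p := by omega
        -- With `t • v + a` in place of `a`, the coefficient of `t` is `(p + 1) • (b * v * a ^ p)`: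
        -- one more factor is polarized, up to a nonzero scalar.
        have := W.mem_of_forall_sum_pow_smul_mem (p + 2)
          (fun i => ((p + 1).choose i : ℝ) • (b * v ^ i * a ^ (p + 1 - i))) (fun t => by
            have h1 := ih (by omega) b hb (t • v + a) (V.add_mem (V.smul_mem t hv) ha)
            rw [hp, add_pow, Finset.mul_sum] at h1
            convert h1 using 2 with i _
            rw [smul_pow, Algebra.smul_def, Algebra.smul_def, Algebra.smul_def, map_natCast]
            ring) (i := 1) (by omega)
        rw [hp']
        have h2 := W.smul_mem (((p + 1).choose 1 : ℝ)⁻¹) this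
        rw [smul_smul, inv_mul_cancel₀ (by simp; positivity), one_smul] at h2
        simpa using h2
  intro b hb
  by_cases hV : m = 0
  · subst hV; simpa using key 0 le_rfl b hb 0 V.zero_mem
  · simpa using key m le_rfl b hb 0 V.zero_mem

/-- Synthetic division: coefficient `i` of `q` is coefficient `i + 1` of the product plus `a` times
coefficient `i + 1` of `q`, so the recursion descends from the leading coefficient. -/
theorem Subalgebra.coeff_mem_of_coeff_mul_X_sub_C_mem {R : Type*} [CommRing R] [Algebra ℝ R]
    (B : Subalgebra ℝ R) (q : Polynomial R) {a : R} (ha : a ∈ B)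
    (h : ∀ i, (q * (Polynomial.X - Polynomial.C a)).coeff i ∈ B) (i : ℕ) : q.coeff i ∈ B := by
  by_cases hi : q.natDegree < i
  · rw [Polynomial.coeff_eq_zero_of_natDegree_lt hi]; exact B.zero_mem
  · have ih := coeff_mem_of_coeff_mul_X_sub_C_mem B q ha h (i + 1)
    have := h (i + 1)
    rw [Polynomial.coeff_mul_X_sub_C] at this
    simpa using B.add_mem this (B.mul_mem ih ha)
termination_by q.natDegree + 1 - i

theorem Subalgebra.coeff_prod_mem {R ι : Type*} [CommRing R] [Algebra ℝ R] [DecidableEq ι]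
    (B : Subalgebra ℝ R) (y : ι → R) (t s : Finset ι) (hst : Disjoint s t)
    (hs : ∀ l ∈ s, y l ∈ B)
    (h : ∀ i, (∏ l ∈ s ∪ t, (Polynomial.X - Polynomial.C (y l))).coeff i ∈ B) :
    ∀ i, (∏ l ∈ t, (Polynomial.X - Polynomial.C (y l))).coeff i ∈ B := by
  induction s using Finset.induction_on with
  | empty => simpa using h
  | insert a s ha ih =>
    rw [Finset.disjoint_insert_left] at hst
    refine ih hst.2 (fun l hl => hs l (Finset.mem_insert_of_mem hl)) ?_
    refine B.coeff_mem_of_coeff_mul_X_sub_C_mem _ (hs a (Finset.mem_insert_self _ _)) ?_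
    intro i
    have := h i
    rwa [Finset.insert_union, Finset.prod_insert (by simp [ha, hst.1]), mul_comm] at this

/-- A root of a monic polynomial of degree `m + 1` with coefficients in `B`. -/
theorem Subalgebra.pow_card_mem {R ι : Type*} [CommRing R] [Algebra ℝ R] [Nontrivial R]
    (B : Subalgebra ℝ R) (y : ι → R) (t : Finset ι) {k : ι} (hk : k ∈ t) {m : ℕ}
    (hm : t.card = m + 1)
    (h : ∀ i, (∏ l ∈ t, (Polynomial.X - Polynomial.C (y l))).coeff i ∈ B)
    (V : Submodule ℝ R) (h1 : 1 ≤ V) (hV : y k ∈ V) :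
    y k ^ (m + 1) ∈ Subalgebra.toSubmodule B * V ^ m := by
  set q := ∏ l ∈ t, (Polynomial.X - Polynomial.C (y l)) with hq
  have hmon : q.Monic := Polynomial.monic_prod_of_monic _ _ fun l _ => Polynomial.monic_X_sub_C _
  have hdeg : q.natDegree = m + 1 := by
    rw [hq, Polynomial.natDegree_prod_of_monic _ _ fun l _ => Polynomial.monic_X_sub_C _]
    simp [hm]
  have hroot : q.eval (y k) = 0 := by
    rw [hq, Polynomial.eval_prod]
    exact Finset.prod_eq_zero hk (by simp)
  rw [Polynomial.eval_eq_sum_range, hdeg, Finset.sum_range_succ, ← hdeg,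
    hmon.coeff_natDegree, hdeg, one_mul] at hroot
  rw [eq_neg_of_add_eq_zero_right hroot]
  refine Submodule.neg_mem _ (Submodule.sum_mem _ fun i hi => ?_)
  refine Submodule.mul_mem_mul (h i) ?_
  exact pow_le_pow_right' h1
    (by rw [Finset.mem_range] at hi; omega : i ≤ m) (Submodule.pow_mem_pow V hV i)

end Generation

/-! ### Generation of the polynomial ring over the symmetric polynomials -/

section Generation

/-- `ℝ` plus the span of the coordinates of `xₖ`: the affine forms in `xₖ`. -/
noncomputable def affineForms (n d : ℕ) (k : Fin n) : Submodule ℝ (PolyRing n d) :=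
  1 ⊔ Submodule.span ℝ (Set.range fun j : Fin d => MvPolynomial.X (k, j))

/-- The algebra generated by the symmetric polynomials and the coordinates of `x₁, …, xₖ`. -/
noncomputable def partialAlgebra (n d k : ℕ) : Subalgebra ℝ (PolyRing n d) :=
  symmetricPolys n d ⊔
    Algebra.adjoin ℝ {p | ∃ v : Fin n × Fin d, v.1.val < k ∧ p = MvPolynomial.X v}

variable {n d : ℕ}

theorem X_mem_partialAlgebra {k : ℕ} {v : Fin n × Fin d} (hv : v.1.val < k) :
    MvPolynomial.X v ∈ partialAlgebra n d k :=
  (le_sup_right : _ ≤ partialAlgebra n d k) (Algebra.subset_adjoin ⟨v, hv, rfl⟩)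

/-- The conjugates of `v` are the same affine form evaluated at each of the other points. -/
theorem exists_affine_family {k : Fin n} {v : PolyRing n d} (hv : v ∈ affineForms n d k) :
    ∃ y : Fin n → PolyRing n d, y k = v ∧ (∀ l, y l ∈ affineForms n d l) ∧
      ∀ (σ : Equiv.Perm (Fin n)) l, permPoly σ (y l) = y (σ l) := by
  rw [affineForms, Submodule.mem_sup] at hv
  obtain ⟨a, ha, b, hb, rfl⟩ := hv
  obtain ⟨c, rfl⟩ := Submodule.mem_one.1 ha
  rw [Submodule.mem_span_range_iff_exists_fun] at hb
  obtain ⟨t, rfl⟩ := hb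
  refine ⟨fun l => algebraMap _ _ c + ∑ j, t j • MvPolynomial.X (l, j), rfl, fun l => ?_,
    fun σ l => ?_⟩
  · refine Submodule.add_mem_sup (Submodule.mem_one.2 ⟨c, rfl⟩) (Submodule.sum_mem _ fun j _ => ?_)
    exact Submodule.smul_mem _ _ (Submodule.subset_span ⟨j, rfl⟩)
  · simp [permPoly]

theorem affineForms_le_partialAlgebra {k : ℕ} {l : Fin n} (hl : l.val < k) :
    affineForms n d l ≤ Subalgebra.toSubmodule (partialAlgebra n d k) := by
  refine sup_le ?_ (Submodule.span_le.2 ?_)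
  · rw [Submodule.one_le]; exact (partialAlgebra n d k).one_mem
  · rintro _ ⟨j, rfl⟩
    exact X_mem_partialAlgebra hl

theorem coeff_prod_mem_symmetricPolys {y : Fin n → PolyRing n d}
    (hy : ∀ (σ : Equiv.Perm (Fin n)) l, permPoly σ (y l) = y (σ l)) (i : ℕ) :
    (∏ l, (Polynomial.X - Polynomial.C (y l))).coeff i ∈ symmetricPolys n d := by
  intro σ
  have : (∏ l, (Polynomial.X - Polynomial.C (y l))).map
      (permPoly σ : PolyRing n d →ₐ[ℝ] PolyRing n d).toRingHom =
      ∏ l, (Polynomial.X - Polynomial.C (y l)) := by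
    rw [Polynomial.map_prod]
    simp only [Polynomial.map_sub, Polynomial.map_X, Polynomial.map_C, AlgHom.toRingHom_eq_coe,
      RingHom.coe_coe, hy]
    exact Equiv.prod_comp σ fun l => Polynomial.X - Polynomial.C (y l)
  conv_rhs => rw [← this, Polynomial.coeff_map]
  rfl

/-- By polarization only powers of a single form matter. The product over all conjugates has
symmetric coefficients; dividing out the `k` earlier ones leaves a monic polynomial of degree `m +
1` over `partialAlgebra n d k`, with the form as a root. -/
theorem affineForms_pow_le {k : Fin n} {m : ℕ} (hm : k.val + m + 1 = n) :
    affineForms n d k ^ (m + 1) ≤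
      Subalgebra.toSubmodule (partialAlgebra n d k) * affineForms n d k ^ m := by
  refine Submodule.pow_le_of_forall_pow_mem _ _ _ fun v hv => ?_
  obtain ⟨y, rfl, hy, hσ⟩ := exists_affine_family hv
  refine Subalgebra.pow_card_mem _ y (Finset.Ici k) (by simp) (by simp; omega) ?_ _
    le_sup_left (hy k)
  refine Subalgebra.coeff_prod_mem _ y _ (Finset.Iio k) ?_ ?_ ?_
  · rw [Finset.disjoint_left]; intro a; simp
  · intro l hl
    exact affineForms_le_partialAlgebra (by simpa using hl) (hy l)
  · have : Finset.Iio k ∪ Finset.Ici k = Finset.univ := by ext a; simp [lt_or_ge]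
    rw [this]
    exact fun i => (le_sup_left : _ ≤ partialAlgebra n d k) (coeff_prod_mem_symmetricPolys hσ i)

theorem partialAlgebra_succ_le {k : Fin n} {m : ℕ} (hm : k.val + m + 1 = n) :
    Subalgebra.toSubmodule (partialAlgebra n d (k + 1)) ≤
      Subalgebra.toSubmodule (partialAlgebra n d k) * affineForms n d k ^ m := by
  set A := Subalgebra.toSubmodule (partialAlgebra n d k) with hA
  set N := A * affineForms n d k ^ m with hN
  have hAA : A * A = A := (partialAlgebra n d k).isIdempotentElem_toSubmodule
  have h1V : (1 : Submodule ℝ (PolyRing n d)) ≤ affineForms n d k := le_sup_left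
  have hNV : N * affineForms n d k ≤ N := by
    calc N * affineForms n d k = A * affineForms n d k ^ (m + 1) := by
          rw [hN, mul_assoc, pow_succ]
      _ ≤ A * (A * affineForms n d k ^ m) := mul_le_mul_right (affineForms_pow_le hm) A
      _ = N := by rw [← mul_assoc, hAA]
  have hNA : N * A ≤ N := by
    rw [hN, mul_right_comm, hAA]
  have hone : (1 : PolyRing n d) ∈ N := by
    have := Submodule.mul_mem_mul (M := A) (N := affineForms n d k ^ m)
      (partialAlgebra n d k).one_mem (Submodule.one_le.1 (one_le_pow_of_one_le' h1V m))
    rwa [one_mul] at this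
  -- The multipliers that preserve `N` form an algebra. It contains the old algebra and the
  -- coordinates of the new point, and since `1 ∈ N` it is contained in `N`.
  let B : Subalgebra ℝ (PolyRing n d) :=
    { carrier := {x | ∀ y ∈ N, y * x ∈ N}
      mul_mem' := fun {a b} ha hb y hy => by rw [← mul_assoc]; exact hb _ (ha _ hy)
      add_mem' := fun {a b} ha hb y hy => by rw [mul_add]; exact N.add_mem (ha _ hy) (hb _ hy)
      algebraMap_mem' := fun r y hy => by
        rw [mul_comm, ← Algebra.smul_def]; exact N.smul_mem _ hy }
  have hAB : partialAlgebra n d k ≤ B := fun x hx y hy => hNA (Submodule.mul_mem_mul hy hx)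
  have hB : partialAlgebra n d (k + 1) ≤ B := by
    refine sup_le (le_sup_left.trans hAB) (Algebra.adjoin_le ?_)
    rintro _ ⟨v, hv, rfl⟩
    rcases Nat.lt_succ_iff_lt_or_eq.1 hv with hv | hv
    · exact hAB (X_mem_partialAlgebra hv)
    · intro y hy
      refine hNV (Submodule.mul_mem_mul hy (Submodule.mem_sup_right (Submodule.subset_span ?_)))
      exact ⟨v.2, by rw [← Fin.ext hv]⟩
  intro x hx
  simpa using hB hx 1 hone

theorem affineForms_le_restrictTotalDegree (k : Fin n) :
    affineForms n d k ≤ MvPolynomial.restrictTotalDegree _ ℝ 1 := by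
  refine sup_le ?_ (Submodule.span_le.2 ?_)
  · rw [Submodule.one_le, MvPolynomial.mem_restrictTotalDegree]; simp
  · rintro _ ⟨j, rfl⟩
    rw [SetLike.mem_coe, MvPolynomial.mem_restrictTotalDegree]; simp

theorem restrictTotalDegree_mul_le {τ : Type*} (a b : ℕ) :
    MvPolynomial.restrictTotalDegree τ ℝ a * MvPolynomial.restrictTotalDegree τ ℝ b ≤
      MvPolynomial.restrictTotalDegree τ ℝ (a + b) := by
  rw [Submodule.mul_le]
  intro p hp q hq
  rw [MvPolynomial.mem_restrictTotalDegree] at *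
  exact (MvPolynomial.totalDegree_mul p q).trans (add_le_add hp hq)

theorem affineForms_pow_le_restrictTotalDegree (k : Fin n) (m : ℕ) :
    affineForms n d k ^ m ≤ MvPolynomial.restrictTotalDegree _ ℝ m := by
  induction m with
  | zero =>
    rw [pow_zero, Submodule.one_le, MvPolynomial.mem_restrictTotalDegree]; simp
  | succ m ih =>
    rw [pow_succ]
    exact (mul_le_mul' ih (affineForms_le_restrictTotalDegree k)).trans
      (restrictTotalDegree_mul_le m 1)

theorem partialAlgebra_le (k : ℕ) (hk : k ≤ n) :
    Subalgebra.toSubmodule (partialAlgebra n d k) ≤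
      Subalgebra.toSubmodule (symmetricPolys n d) *
        MvPolynomial.restrictTotalDegree _ ℝ (∑ i ∈ Finset.range k, (n - 1 - i)) := by
  induction k with
  | zero =>
    have : partialAlgebra n d 0 = symmetricPolys n d := by simp [partialAlgebra]
    rw [this]
    intro x hx
    rw [← mul_one x]
    refine Submodule.mul_mem_mul hx ?_
    rw [MvPolynomial.mem_restrictTotalDegree]; simp
  | succ k ih =>
    have h := partialAlgebra_succ_le (d := d) (k := ⟨k, hk⟩) (m := n - 1 - k)
      (by simp; omega)
    refine h.trans ((mul_le_mul' (ih (by omega))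
      (affineForms_pow_le_restrictTotalDegree _ _)).trans ?_)
    rw [mul_assoc, Finset.sum_range_succ]
    exact mul_le_mul_right (restrictTotalDegree_mul_le _ _) _

/-- The polynomial ring is generated over the symmetric polynomials in degrees `≤ C(n, 2)`. -/
theorem top_le_symmetricPolys_mul (n d : ℕ) :
    ⊤ ≤ Subalgebra.toSubmodule (symmetricPolys n d) *
        MvPolynomial.restrictTotalDegree (Fin n × Fin d) ℝ (n.choose 2) := by
  have h1 : partialAlgebra n d n = ⊤ := by
    rw [eq_top_iff, ← MvPolynomial.adjoin_range_X]
    refine Algebra.adjoin_le ?_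
    rintro _ ⟨v, rfl⟩
    exact X_mem_partialAlgebra v.1.2
  have h2 := partialAlgebra_le (d := d) n le_rfl
  rwa [h1, Finset.sum_range_reflect (fun i => i) n, Finset.sum_range_id, ← Nat.choose_two_right,
    Algebra.top_toSubmodule] at h2

end Generation

/-! ### Antisymmetrized monomials and the upper bound -/

section Antisymmetrization

variable {n d : ℕ}

/-- `p ↦ ∑_σ sgn σ · p(σ.x)`. -/
noncomputable def antisymmetrize (n d : ℕ) : PolyRing n d →ₗ[ℝ] PolyRing n d :=
  ∑ σ : Equiv.Perm (Fin n), (((Equiv.Perm.sign σ : ℤˣ) : ℤ) : ℝ) • (permPoly σ).toLinearMap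

theorem antisymmetrize_apply (p : PolyRing n d) :
    antisymmetrize n d p =
      ∑ σ : Equiv.Perm (Fin n), (((Equiv.Perm.sign σ : ℤˣ) : ℤ) : PolyRing n d) * permPoly σ p := by
  simp [antisymmetrize, LinearMap.sum_apply, Algebra.smul_def]

theorem permPoly_permPoly (σ τ : Equiv.Perm (Fin n)) (p : PolyRing n d) :
    permPoly σ (permPoly τ p) = permPoly (σ * τ) p := by
  simp only [permPoly, MvPolynomial.rename_rename]
  rfl

theorem sign_mul_sign_self {R : Type*} [CommRing R] (σ : Equiv.Perm (Fin n)) :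
    (((Equiv.Perm.sign σ : ℤˣ) : ℤ) : R) * (((Equiv.Perm.sign σ : ℤˣ) : ℤ) : R) = 1 := by
  rw [← Int.cast_mul, ← Units.val_mul, Int.units_mul_self]; simp

theorem antisymmetrize_mem_alternants (p : PolyRing n d) :
    antisymmetrize n d p ∈ alternants n d := by
  intro σ
  simp only [antisymmetrize_apply, map_sum, map_mul, map_intCast, permPoly_permPoly,
    Finset.mul_sum]
  rw [← Equiv.sum_comp (Equiv.mulLeft σ)
    (fun τ => (((Equiv.Perm.sign σ : ℤˣ) : ℤ) : PolyRing n d) *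
      ((((Equiv.Perm.sign τ : ℤˣ) : ℤ) : PolyRing n d) * permPoly τ p))]
  refine Finset.sum_congr rfl fun τ _ => ?_
  simp only [Equiv.coe_mulLeft, Equiv.Perm.sign_mul, Units.val_mul, Int.cast_mul]
  rw [← mul_assoc, ← mul_assoc, sign_mul_sign_self, one_mul]

theorem antisymmetrize_of_mem_alternants {p : PolyRing n d} (hp : p ∈ alternants n d) :
    antisymmetrize n d p = (n.factorial : ℝ) • p := by
  rw [antisymmetrize_apply, Finset.sum_congr rfl fun σ _ => by
    rw [hp σ, ← mul_assoc, sign_mul_sign_self, one_mul]]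
  simp [Fintype.card_perm, Algebra.smul_def]

theorem antisymmetrize_mul {s : PolyRing n d} (hs : s ∈ symmetricPolys n d) (p : PolyRing n d) :
    antisymmetrize n d (s * p) = s * antisymmetrize n d p := by
  simp only [antisymmetrize_apply, map_mul, Finset.mul_sum]
  refine Finset.sum_congr rfl fun σ _ => ?_
  rw [hs σ]; ring

theorem isHomogeneous_antisymmetrize {p : PolyRing n d} {m : ℕ} (hp : p.IsHomogeneous m) :
    (antisymmetrize n d p).IsHomogeneous m := by
  rw [antisymmetrize_apply]
  refine MvPolynomial.IsHomogeneous.sum _ _ _ fun σ _ => ?_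
  have h1 : ((((Equiv.Perm.sign σ : ℤˣ) : ℤ) : PolyRing n d)).IsHomogeneous 0 := by
    simpa using MvPolynomial.isHomogeneous_C (Fin n × Fin d) (((Equiv.Perm.sign σ : ℤˣ) : ℤ) : ℝ)
  have := h1.mul (hp.rename_isHomogeneous (f := Prod.map σ id))
  rwa [zero_add] at this

theorem homogeneousComponent_mem_symmetricPolys {p : PolyRing n d} (hp : p ∈ symmetricPolys n d)
    (m : ℕ) : MvPolynomial.homogeneousComponent m p ∈ symmetricPolys n d := by
  intro σ
  rw [permPoly, MvPolynomial.rename_homogeneousComponent]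
  exact congrArg _ (hp σ)

/-- The antisymmetrization of a monomial. -/
noncomputable def slater {n d : ℕ} (a : Fin n × Fin d →₀ ℕ) : PolyRing n d :=
  antisymmetrize n d (MvPolynomial.monomial a 1)

/-- Antisymmetrizing a symmetric combination of low-degree monomials gives the same combination of
their antisymmetrizations, and every alternant is `1 / n!` times its own antisymmetrization. -/
theorem span_slater (n d : ℕ) :
    Submodule.span (symmetricPolys n d)
      (slater '' {a : Fin n × Fin d →₀ ℕ | a.degree ≤ n.choose 2}) = alternants n d := by
  refine le_antisymm (Submodule.span_le.2 ?_) fun p hp => ?_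
  · rintro _ ⟨a, -, rfl⟩
    exact antisymmetrize_mem_alternants _
  set M := Submodule.span (symmetricPolys n d)
      (slater '' {a : Fin n × Fin d →₀ ℕ | a.degree ≤ n.choose 2}) with hM
  have key : ∀ q : PolyRing n d, antisymmetrize n d q ∈ M := by
    intro q
    have hq := top_le_symmetricPolys_mul n d (Submodule.mem_top (x := q))
    induction hq using Submodule.mul_induction_on' with
    | add x _ y _ hx hy => rw [map_add]; exact M.add_mem hx hy
    | mem_mul_mem s hs b hb =>
      rw [antisymmetrize_mul hs]
      refine M.smul_mem ⟨s, hs⟩ ?_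
      rw [MvPolynomial.mem_restrictTotalDegree] at hb
      rw [b.as_sum, map_sum]
      refine M.sum_mem fun a ha => ?_
      have h1 : MvPolynomial.monomial a (b.coeff a) =
          b.coeff a • MvPolynomial.monomial a (1 : ℝ) := by
        rw [MvPolynomial.smul_monomial]; simp
      rw [h1, map_smul]
      refine Submodule.smul_of_tower_mem M _ (Submodule.subset_span ⟨a, ?_, rfl⟩)
      exact (MvPolynomial.le_totalDegree ha).trans hb
  have h := key p
  rw [antisymmetrize_of_mem_alternants hp] at h
  have h2 := Submodule.smul_of_tower_mem M ((n.factorial : ℝ)⁻¹) h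
  rwa [smul_smul, inv_mul_cancel₀ (by positivity), one_smul] at h2

theorem slater_mem_alternants (a : Fin n × Fin d →₀ ℕ) : slater a ∈ alternants n d :=
  antisymmetrize_mem_alternants _

theorem slater_isHomogeneous (a : Fin n × Fin d →₀ ℕ) : (slater a).IsHomogeneous a.degree :=
  isHomogeneous_antisymmetrize (MvPolynomial.isHomogeneous_monomial 1 rfl)

/-- The exponents of degree at most `N`. -/
def exponentsLE (τ : Type*) [Fintype τ] [DecidableEq τ] (N : ℕ) : Finset (τ →₀ ℕ) :=
  (Finset.range (N + 1)).biUnion fun m => Finset.finsuppAntidiag Finset.univ m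

theorem mem_exponentsLE {τ : Type*} [Fintype τ] [DecidableEq τ] {N : ℕ} {a : τ →₀ ℕ} :
    a ∈ exponentsLE τ N ↔ a.degree ≤ N := by
  simp [exponentsLE, Finset.mem_finsuppAntidiag, Finsupp.degree_eq_sum]

theorem card_exponentsLE (τ : Type*) [Fintype τ] [DecidableEq τ] (N : ℕ) :
    (exponentsLE τ N).card = (N + Fintype.card τ).choose (Fintype.card τ) := by
  rw [exponentsLE, Finset.card_biUnion]
  · simp only [Finset.card_finsuppAntidiag_nat_eq_multichoose, Finset.card_univ]
    rw [Nat.sum_range_multichoose]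
  · intro x _ y _ hxy
    rw [Function.onFun, Finset.disjoint_left]
    intro a ha hb
    rw [Finset.mem_finsuppAntidiag] at ha hb
    exact hxy (ha.1.symm.trans hb.1)

theorem span_slater_exponentsLE (n d : ℕ) :
    Submodule.span (symmetricPolys n d)
      (slater '' (exponentsLE (Fin n × Fin d) (n.choose 2) : Set (Fin n × Fin d →₀ ℕ))) =
      alternants n d := by
  rw [← span_slater]
  congr 2
  ext a
  exact mem_exponentsLE

theorem alternants_fg (n d : ℕ) : (alternants n d).FG := by
  classical
  exact ⟨(exponentsLE (Fin n × Fin d) (n.choose 2)).image slater, by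
    rw [Finset.coe_image, span_slater_exponentsLE]⟩

theorem spanFinrank_alternants_le (n d : ℕ) :
    (alternants n d).spanFinrank ≤ (n.choose 2 + d * n).choose (d * n) := by
  have h1 := Submodule.spanFinrank_span_le_ncard_of_finite (R := symmetricPolys n d)
    (((exponentsLE (Fin n × Fin d) (n.choose 2)).finite_toSet).image slater)
  rw [span_slater_exponentsLE] at h1
  refine h1.trans ((Set.ncard_image_le (Finset.finite_toSet _)).trans ?_)
  rw [Set.ncard_coe_finset]
  rw [card_exponentsLE]
  simp [mul_comm]

end Antisymmetrization

/-! ### Minimal generators by graded Nakayama -/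

section MinimalGenerators

variable {n d : ℕ}

/-- Under `π` symmetric coefficients act through their constant terms, so module generators become a
real spanning set. -/
theorem map_mem_span_image {V : Type*} [AddCommGroup V] [Module ℝ V]
    (π : PolyRing n d →ₗ[ℝ] V)
    (hπ : ∀ s ∈ symmetricPolys n d, ∀ a ∈ alternants n d, π (s * a) = s.coeff 0 • π a)
    {T : Set (PolyRing n d)} (hT : Submodule.span (symmetricPolys n d) T = alternants n d)
    {p : PolyRing n d} (hp : p ∈ alternants n d) : π p ∈ Submodule.span ℝ (π '' T) := by
  rw [← hT] at hp
  induction hp using Submodule.span_induction with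
  | mem x hx => exact Submodule.subset_span ⟨x, hx, rfl⟩
  | zero => rw [map_zero]; exact Submodule.zero_mem _
  | add x y _ _ hx hy => rw [map_add]; exact Submodule.add_mem _ hx hy
  | smul s x hx ih =>
    rw [hT] at hx
    rw [Subalgebra.smul_def, smul_eq_mul, hπ s s.2 x hx]
    exact Submodule.smul_mem _ _ ih

/-- Alternants whose images under a map that kills `S₊ · A` are independent are at most as many
as any generators. -/
theorem card_le_spanFinrank {V : Type*} [AddCommGroup V] [Module ℝ V]
    (π : PolyRing n d →ₗ[ℝ] V)
    (hπ : ∀ s ∈ symmetricPolys n d, ∀ a ∈ alternants n d, π (s * a) = s.coeff 0 • π a)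
    {ι : Type*} [Fintype ι] (v : ι → PolyRing n d) (hv : ∀ i, v i ∈ alternants n d)
    (hli : LinearIndependent ℝ (fun i => π (v i))) :
    Fintype.card ι ≤ (alternants n d).spanFinrank := by
  classical
  obtain ⟨T, hTc, hT⟩ := (alternants_fg n d).exists_span_finset_card_eq_spanFinrank
  rw [← hTc, ← finrank_span_eq_card hli]
  have h1 : Submodule.span ℝ (Set.range fun i => π (v i)) ≤
      Submodule.span ℝ ((T.image π : Finset V) : Set V) := by
    rw [Submodule.span_le]
    rintro _ ⟨i, rfl⟩
    rw [Finset.coe_image]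
    exact map_mem_span_image π hπ hT (hv i)
  have : FiniteDimensional ℝ (Submodule.span ℝ ((T.image π : Finset V) : Set V)) :=
    FiniteDimensional.span_finset ℝ _
  refine (Submodule.finrank_mono h1).trans ((finrank_span_finset_le_card _).trans ?_)
  exact Finset.card_image_le

/-- The alternants that are combinations of alternants with symmetric coefficients without constant
term. -/
noncomputable def augmentedAlternants (n d : ℕ) : Submodule ℝ (PolyRing n d) :=
  Submodule.span ℝ {p | ∃ s ∈ symmetricPolys n d, s.coeff 0 = 0 ∧ ∃ a ∈ alternants n d, p = s * a}

theorem mkQ_augmentedAlternants_mul {s a : PolyRing n d} (hs : s ∈ symmetricPolys n d)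
    (ha : a ∈ alternants n d) :
    (augmentedAlternants n d).mkQ (s * a) = s.coeff 0 • (augmentedAlternants n d).mkQ a := by
  rw [← map_smul, ← sub_eq_zero, ← map_sub, Submodule.mkQ_apply, Submodule.Quotient.mk_eq_zero]
  refine Submodule.subset_span ⟨s - MvPolynomial.C (s.coeff 0), ?_, by simp, a, ha, ?_⟩
  · exact sub_mem hs ((symmetricPolys n d).algebraMap_mem _)
  · rw [sub_mul, MvPolynomial.smul_eq_C_mul]

theorem homogeneousComponent_mul_mem {τ : Type*} (M : Submodule ℝ (MvPolynomial τ ℝ)) (m : ℕ)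
    (s a : MvPolynomial τ ℝ)
    (h : ∀ i j, i + j = m → MvPolynomial.homogeneousComponent i s *
      MvPolynomial.homogeneousComponent j a ∈ M) :
    MvPolynomial.homogeneousComponent m (s * a) ∈ M := by
  rw [← MvPolynomial.sum_homogeneousComponent s, ← MvPolynomial.sum_homogeneousComponent a,
    Finset.sum_mul_sum, map_sum]
  refine M.sum_mem fun i _ => ?_
  rw [map_sum]
  refine M.sum_mem fun j _ => ?_
  rw [MvPolynomial.homogeneousComponent_of_mem (n := i + j)
    ((MvPolynomial.homogeneousComponent_isHomogeneous i s).mul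
      (MvPolynomial.homogeneousComponent_isHomogeneous j a))]
  split_ifs with hij
  · exact h i j hij.symm
  · exact M.zero_mem

/-- Graded Nakayama lemma for the alternants. -/
theorem le_span_of_le_span_sup (B : Set (PolyRing n d)) (hB : ∀ b ∈ B, ∃ m, b.IsHomogeneous m)
    (h : ∀ p ∈ alternants n d, p ∈ Submodule.span ℝ B ⊔ augmentedAlternants n d) :
    alternants n d ≤ Submodule.span (symmetricPolys n d) B := by
  set M := Submodule.span (symmetricPolys n d) B with hM
  have hBM : Submodule.span ℝ B ≤ M.restrictScalars ℝ :=
    Submodule.span_le.2 fun b hb => Submodule.subset_span hb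
  -- A coefficient component of positive degree multiplies an alternant component of degree below
  -- `m`, which strong induction covers.
  have key : ∀ m : ℕ, ∀ p ∈ alternants n d, MvPolynomial.homogeneousComponent m p ∈ M := by
    intro m
    induction m using Nat.strong_induction_on with
    | _ m ih =>
    intro p hp
    have h1 : Submodule.span ℝ B ⊔ augmentedAlternants n d ≤
        (M.restrictScalars ℝ).comap (MvPolynomial.homogeneousComponent m) := by
      refine sup_le (Submodule.span_le.2 fun b hb => ?_) (Submodule.span_le.2 ?_)
      · obtain ⟨k, hk⟩ := hB b hb
        rw [SetLike.mem_coe, Submodule.mem_comap, MvPolynomial.homogeneousComponent_of_mem hk]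
        split_ifs
        · exact Submodule.subset_span hb
        · exact Submodule.zero_mem _
      · rintro _ ⟨s, hs, hs0, a, ha, rfl⟩
        rw [SetLike.mem_coe, Submodule.mem_comap]
        refine homogeneousComponent_mul_mem _ m s a fun i j hij => ?_
        rcases Nat.eq_zero_or_pos i with rfl | hi
        · rw [MvPolynomial.homogeneousComponent_zero, hs0, map_zero, zero_mul]
          exact Submodule.zero_mem _
        · exact M.smul_mem ⟨_, homogeneousComponent_mem_symmetricPolys hs i⟩
            (ih j (by omega) a ha)
    exact h1 (h p hp)
  intro p hp
  rw [← MvPolynomial.sum_homogeneousComponent p]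
  exact M.sum_mem fun m _ => key m p hp

/-- A subfamily of the antisymmetrized monomials maps to a basis of the image of the alternants
modulo `augmentedAlternants`. It generates by Nakayama, so it is not too small; it is independent in
the quotient, so it is not too large. -/
theorem exists_minimal_homogeneous_generators (n d : ℕ) :
    ∃ g : Fin (alternants n d).spanFinrank → PolyRing n d,
      (∀ i, g i ∈ alternants n d) ∧
      (∀ i, ∃ m : ℕ, m ≤ n.choose 2 ∧ (g i).IsHomogeneous m) ∧
      Submodule.span (symmetricPolys n d) (Set.range g) = alternants n d := by
  classical
  set G := exponentsLE (Fin n × Fin d) (n.choose 2)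
  set π := (augmentedAlternants n d).mkQ
  obtain ⟨κ, f, hf, hspan, hli⟩ := exists_linearIndependent' ℝ (fun a : G => π (slater a.1))
  have : Finite κ := Finite.of_injective f hf
  have := Fintype.ofFinite κ
  let v : κ → PolyRing n d := fun i => slater (f i).1
  have hv : ∀ i, v i ∈ alternants n d := fun i => slater_mem_alternants _
  have hle : Fintype.card κ ≤ (alternants n d).spanFinrank :=
    card_le_spanFinrank π (fun s hs a ha => mkQ_augmentedAlternants_mul hs ha) v hv hli
  have hgen : Submodule.span (symmetricPolys n d) (Set.range v) = alternants n d := by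
    refine le_antisymm (Submodule.span_le.2 ?_) (le_span_of_le_span_sup _ ?_ fun p hp => ?_)
    · rintro _ ⟨i, rfl⟩; exact hv i
    · rintro _ ⟨i, rfl⟩; exact ⟨_, slater_isHomogeneous _⟩
    · have h1 := map_mem_span_image π (fun s hs a ha => mkQ_augmentedAlternants_mul hs ha)
        (span_slater_exponentsLE n d) hp
      have h2 : π '' (slater '' (G : Set (Fin n × Fin d →₀ ℕ))) =
          Set.range (fun a : G => π (slater a.1)) := by
        ext x; simp [Set.mem_image]
      rw [h2, ← hspan] at h1
      have h3 : Set.range ((fun a : G => π (slater a.1)) ∘ f) = π '' Set.range v := by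
        rw [← Set.range_comp]; rfl
      rw [h3, Submodule.span_image] at h1
      obtain ⟨q, hq, hqp⟩ := h1
      rw [Submodule.mem_sup]
      refine ⟨q, hq, p - q, ?_, by ring⟩
      rw [← Submodule.Quotient.mk_eq_zero, ← Submodule.mkQ_apply, map_sub, sub_eq_zero]
      exact hqp.symm
  have hge : (alternants n d).spanFinrank ≤ Fintype.card κ := by
    rw [← hgen]
    refine (Submodule.spanFinrank_span_le_ncard_of_finite (Set.finite_range v)).trans ?_
    rw [← Set.image_univ]
    refine (Set.ncard_image_le Set.finite_univ).trans ?_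
    rw [Set.ncard_univ, Nat.card_eq_fintype_card]
  let e : Fin (alternants n d).spanFinrank ≃ κ :=
    (Fintype.equivFinOfCardEq (le_antisymm hle hge)).symm
  refine ⟨v ∘ e, fun i => hv _, fun i => ⟨_, ?_, slater_isHomogeneous _⟩, ?_⟩
  · exact mem_exponentsLE.1 (f (e i)).2
  · rw [e.surjective.range_comp, hgen]

end MinimalGenerators

/-! ### The lower bound from alternants of least degree -/

section LowerBound

/-- By Pascal's rule the intervals from `C(r, d)` up to but excluding `C(r + 1, d)` tile the natural
numbers; the first nonempty one, at `r = d - 1`, is `{0}`. -/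
theorem Nat.existsUnique_choose_add (d n : ℕ) (hd : 1 ≤ d) :
    ∃! rj : ℕ × ℕ, n = rj.1.choose d + rj.2 ∧ rj.2 < rj.1.choose (d - 1) := by
  obtain ⟨e, rfl⟩ : ∃ e, d = e + 1 := ⟨d - 1, by omega⟩
  rw [Nat.add_sub_cancel]
  have hlt : ∀ r j r' j' : ℕ, n = r.choose (e + 1) + j → j < r.choose e →
      n = r'.choose (e + 1) + j' → ¬ r < r' := by
    intro r j r' j' h1 h2 h3 hr
    have := Nat.choose_le_choose (e + 1) (Nat.succ_le_of_lt hr)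
    have h4 := Nat.choose_succ_succ r e
    simp only [Nat.succ_eq_add_one] at this h4
    omega
  have hex : ∃ r j : ℕ, n = r.choose (e + 1) + j ∧ j < r.choose e := by
    clear hlt
    induction n with
    | zero => exact ⟨e, 0, by simp, by simp⟩
    | succ n ih =>
      obtain ⟨r, j, h1, h2⟩ := ih
      by_cases hj : j + 1 < r.choose e
      · exact ⟨r, j + 1, by omega, hj⟩
      · refine ⟨r + 1, 0, ?_, ?_⟩
        · have h4 := Nat.choose_succ_succ r e
          simp only [Nat.succ_eq_add_one] at h4
          omega
        · have : e ≤ r := by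
            by_contra h
            rw [Nat.choose_eq_zero_of_lt (by omega)] at h2
            omega
          exact Nat.choose_pos (by omega)
  obtain ⟨r, j, h1, h2⟩ := hex
  refine ⟨(r, j), ⟨h1, h2⟩, ?_⟩
  rintro ⟨r', j'⟩ ⟨h3, h4⟩
  have h5 := hlt _ _ _ _ h1 h2 h3
  have h6 := hlt _ _ _ _ h3 h4 h1
  obtain rfl : r' = r := by simp only at h5 h6; omega
  ext
  · rfl
  · simp only at h3; simp only; omega

variable {n d : ℕ}

/-- The exponent of `xᵢ` in a monomial. -/
noncomputable def rowExponent (c : Fin n × Fin d →₀ ℕ) (i : Fin n) : Fin d →₀ ℕ :=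
  Finsupp.equivFunOnFinite.symm fun j => c (i, j)

/-- The monomial with given exponents of the `xᵢ`. -/
noncomputable def ofRowExponents (b : Fin n → Fin d →₀ ℕ) : Fin n × Fin d →₀ ℕ :=
  Finsupp.equivFunOnFinite.symm fun v => b v.1 v.2

theorem degree_eq_sum_rowExponent (c : Fin n × Fin d →₀ ℕ) :
    c.degree = ∑ i, (rowExponent c i).degree := by
  simp [Finsupp.degree_eq_sum, Fintype.sum_prod_type, rowExponent]

theorem degree_ofRowExponents (b : Fin n → Fin d →₀ ℕ) :
    (ofRowExponents b).degree = ∑ i, (b i).degree := by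
  simp [Finsupp.degree_eq_sum, Fintype.sum_prod_type, ofRowExponents]

theorem mapDomain_perm_apply (σ : Equiv.Perm (Fin n)) (c : Fin n × Fin d →₀ ℕ) (i : Fin n)
    (j : Fin d) : Finsupp.mapDomain (Prod.map σ id) c (σ i, j) = c (i, j) :=
  Finsupp.mapDomain_apply (f := Prod.map σ id) (σ.injective.prodMap Function.injective_id) c (i, j)

/-- If two points had the same exponent, swapping them would fix the monomial and negate its
coefficient. -/
theorem rowExponent_injective_of_mem_support {p : PolyRing n d} (hp : p ∈ alternants n d)
    {c : Fin n × Fin d →₀ ℕ} (hc : p.coeff c ≠ 0) : Function.Injective (rowExponent c) := by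
  intro i i' hii
  by_contra hne
  apply hc
  have h1 := congrArg (MvPolynomial.coeff c) (hp (Equiv.swap i i'))
  have h2 : Finsupp.mapDomain (Prod.map (Equiv.swap i i') id) c = c := by
    ext ⟨l, j⟩
    have h3 := mapDomain_perm_apply (Equiv.swap i i') c (Equiv.swap i i' l) j
    rw [Equiv.swap_apply_self] at h3
    rw [h3]
    have h4 : c (i, j) = c (i', j) := by
      simpa [rowExponent] using DFunLike.congr_fun hii j
    rw [Equiv.swap_apply_def]
    split_ifs with ha hb
    · rw [ha, h4]
    · rw [hb, h4]
    · rfl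
  have h5 : MvPolynomial.coeff c (permPoly (Equiv.swap i i') p) = p.coeff c := by
    conv_lhs => rw [← h2]
    exact MvPolynomial.coeff_rename_mapDomain _
      ((Equiv.swap i i').injective.prodMap Function.injective_id) _ _
  rw [h5, Equiv.Perm.sign_swap hne] at h1
  simp at h1
  linarith

theorem coeff_slater_ofRowExponents {b b' : Fin n → Fin d →₀ ℕ} (hb : Function.Injective b) :
    (Set.range b ≠ Set.range b' → (slater (ofRowExponents b)).coeff (ofRowExponents b') = 0) ∧
      (slater (ofRowExponents b)).coeff (ofRowExponents b) = 1 := by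
  have key : ∀ (σ : Equiv.Perm (Fin n)) (b' : Fin n → Fin d →₀ ℕ),
      Finsupp.mapDomain (Prod.map σ id) (ofRowExponents b) = ofRowExponents b' →
      ∀ i, b i = b' (σ i) := by
    intro σ b' h i
    ext j
    have := mapDomain_perm_apply σ (ofRowExponents b) i j
    rw [h] at this
    simpa [ofRowExponents] using this.symm
  have hco : ∀ c, (slater (ofRowExponents b)).coeff c =
      ∑ σ : Equiv.Perm (Fin n), (((Equiv.Perm.sign σ : ℤˣ) : ℤ) : ℝ) *
        if Finsupp.mapDomain (Prod.map σ id) (ofRowExponents b) = c then 1 else 0 := by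
    intro c
    rw [slater, antisymmetrize]
    simp only [LinearMap.sum_apply, LinearMap.smul_apply, AlgHom.toLinearMap_apply, permPoly,
      MvPolynomial.rename_monomial, MvPolynomial.coeff_sum, MvPolynomial.coeff_smul,
      MvPolynomial.coeff_monomial, smul_eq_mul]
  constructor
  · intro hne
    rw [hco]
    refine Finset.sum_eq_zero fun σ _ => ?_
    rw [if_neg, mul_zero]
    intro h
    apply hne
    rw [← σ.surjective.range_comp b']
    exact congrArg Set.range (funext (key σ b' h))
  · rw [hco, Finset.sum_eq_single 1]
    · rw [if_pos]
      · simp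
      · ext ⟨i, j⟩
        exact mapDomain_perm_apply 1 (ofRowExponents b) i j
    · intro σ _ hσ
      rw [if_neg, mul_zero]
      intro h
      exact hσ (Equiv.ext fun i => (hb (key σ b h i)).symm)
    · simp

/-- `n = #B + j` distinct exponents have total degree at least that of `B`, the exponents of degree
`≤ s`, plus `j (s + 1)`. -/
theorem le_sum_degree_of_injective {s j : ℕ} (hn : n = (exponentsLE (Fin d) s).card + j)
    {b : Fin n → Fin d →₀ ℕ} (hb : Function.Injective b) :
    ∑ x ∈ exponentsLE (Fin d) s, x.degree + j * (s + 1) ≤ ∑ i, (b i).degree := by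
  classical
  -- The truncated deficit `s + 1 - degree` vanishes outside the exponents of degree at most `s`, so
  -- distinct exponents have at most the total deficit of that set.
  have h1 : ∑ i, (s + 1 - (b i).degree) ≤ ∑ x ∈ exponentsLE (Fin d) s, (s + 1 - x.degree) := by
    rw [← Finset.sum_image (s := Finset.univ) (g := b) (f := fun x => s + 1 - x.degree)
      fun x _ y _ h => hb h]
    refine Finset.sum_le_sum_of_ne_zero fun x _ hx => ?_
    rw [mem_exponentsLE]
    omega
  have h2 : n * (s + 1) ≤ ∑ i, (s + 1 - (b i).degree) + ∑ i, (b i).degree := by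
    rw [← Finset.sum_add_distrib]
    calc n * (s + 1) = ∑ _i : Fin n, (s + 1) := by simp
      _ ≤ _ := Finset.sum_le_sum fun i _ => by omega
  have h3 : ∑ x ∈ exponentsLE (Fin d) s, (s + 1 - x.degree) +
      ∑ x ∈ exponentsLE (Fin d) s, x.degree = (exponentsLE (Fin d) s).card * (s + 1) := by
    rw [← Finset.sum_add_distrib, Finset.sum_const_nat]
    intro x hx
    rw [mem_exponentsLE] at hx
    omega
  have h4 : n * (s + 1) = (exponentsLE (Fin d) s).card * (s + 1) + j * (s + 1) := by
    conv_lhs => rw [hn]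
    ring
  omega

/-- The binomial coefficient counts the `j`-subsets of `Λ`, the exponents of degree exactly `s + 1`.
Each is completed by all of `B` to the exponents of one alternant of degree `D`, and projection to
degree `D` is a map to which `card_le_spanFinrank` applies. -/
theorem choose_le_spanFinrank {s j : ℕ} (hd : 1 ≤ d) (hn : n = (s + d).choose d + j) :
    ((s + d).choose (d - 1)).choose j ≤ (alternants n d).spanFinrank := by
  classical
  set B := exponentsLE (Fin d) s with hB
  set Λ := Finset.finsuppAntidiag (Finset.univ : Finset (Fin d)) (s + 1) with hΛ
  have hBc : B.card = (s + d).choose d := by rw [hB, card_exponentsLE, Fintype.card_fin]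
  have hΛc : Λ.card = (s + d).choose (d - 1) := by
    rw [hΛ, Finset.card_finsuppAntidiag_nat_eq_multichoose, Finset.card_univ, Fintype.card_fin,
      Nat.multichoose_eq]
    rw [show d + (s + 1) - 1 = s + d by omega]
    exact Nat.choose_symm_of_eq_add (by omega)
  have hdeg : ∀ x ∈ Λ, x.degree = s + 1 := fun x hx => by
    rw [hΛ, Finset.mem_finsuppAntidiag] at hx
    rw [Finsupp.degree_eq_sum, ← hx.1]
  have hdisj : Disjoint B Λ := by
    rw [Finset.disjoint_left]
    intro x hx hx'
    have := hdeg x hx'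
    rw [hB, mem_exponentsLE] at hx
    omega
  set ι := Λ.powersetCard j
  have hJ : ∀ J : ι, J.1 ⊆ Λ ∧ J.1.card = j := fun J => Finset.mem_powersetCard.1 J.2
  have hdJ : ∀ J : ι, Disjoint B J.1 := fun J => Finset.disjoint_of_subset_right (hJ J).1 hdisj
  have hcard : ∀ J : ι, (B ∪ J.1).card = n := fun J => by
    rw [Finset.card_union_of_disjoint (hdJ J), hBc, (hJ J).2, hn]
  let e : ∀ J : ι, Fin n ≃ (B ∪ J.1 : Finset _) := fun J =>
    (Finset.equivFinOfCardEq (hcard J)).symm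
  let b : ι → Fin n → Fin d →₀ ℕ := fun J i => (e J i).1
  have hb : ∀ J, Function.Injective (b J) := fun J =>
    Subtype.val_injective.comp (e J).injective
  have hrange : ∀ J : ι, Set.range (b J) = ((B ∪ J.1 : Finset _) : Set (Fin d →₀ ℕ)) := fun J => by
    change Set.range (Subtype.val ∘ e J) = _
    rw [(e J).surjective.range_comp]
    exact Subtype.range_val
  have hrne : ∀ J J' : ι, J ≠ J' → Set.range (b J) ≠ Set.range (b J') := by
    intro J J' hne h
    rw [hrange, hrange, Finset.coe_inj] at h
    apply hne
    refine Subtype.ext (Finset.ext fun x => ?_)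
    have hx := Finset.ext_iff.1 h x
    simp only [Finset.mem_union] at hx
    have h1  : x ∈ B → x ∉ J.1 := fun h => Finset.disjoint_left.1 (hdJ J) h
    have h2  : x ∈ B → x ∉ J'.1 := fun h => Finset.disjoint_left.1 (hdJ J') h
    tauto
  set D := ∑ x ∈ B, x.degree + j * (s + 1) with hD
  have hlow : ∀ p ∈ alternants n d, ∀ k < D, MvPolynomial.homogeneousComponent k p = 0 := by
    intro p hp k hk
    ext c
    rw [MvPolynomial.coeff_homogeneousComponent, MvPolynomial.coeff_zero]
    split_ifs with hc
    · by_contra hne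
      have h1 := le_sum_degree_of_injective (s := s) (j := j) (by rw [← hB, hBc, hn])
        (rowExponent_injective_of_mem_support hp hne)
      rw [← degree_eq_sum_rowExponent, hc, ← hB, ← hD] at h1
      omega
    · rfl
  have hbdeg : ∀ J, (ofRowExponents (b J)).degree = D := by
    intro J
    rw [degree_ofRowExponents, hD]
    have h1 : ∑ i, (b J i).degree = ∑ x ∈ B ∪ J.1, x.degree := by
      rw [← Finset.sum_coe_sort (B ∪ J.1)]
      exact Equiv.sum_comp (e J) fun x : (B ∪ J.1 : Finset _) => x.1.degree
    rw [h1, Finset.sum_union (hdJ J), Finset.sum_const_nat (s := J.1) (m := s + 1), (hJ J).2]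
    exact fun x hx => hdeg x ((hJ J).1 hx)
  -- Alternants have no component below degree `D`, so only the constant term of `q` contributes to
  -- degree `D`.
  have hπ : ∀ q ∈ symmetricPolys n d, ∀ a ∈ alternants n d,
      MvPolynomial.homogeneousComponent D (q * a) =
        q.coeff 0 • MvPolynomial.homogeneousComponent D a := by
    intro q _ a ha
    rw [← map_smul, ← sub_eq_zero, ← map_sub, MvPolynomial.smul_eq_C_mul, ← sub_mul]
    refine (Submodule.mem_bot ℝ).1 (homogeneousComponent_mul_mem ⊥ D _ a fun i k hik => ?_)
    rw [Submodule.mem_bot]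
    rcases Nat.eq_zero_or_pos i with rfl | hi
    · rw [MvPolynomial.homogeneousComponent_zero]; simp
    · rw [hlow a ha k (by omega), mul_zero]
  have hli : LinearIndependent ℝ fun J : ι =>
      MvPolynomial.homogeneousComponent D (slater (ofRowExponents (b J))) := by
    have h1 : ∀ J : ι, MvPolynomial.homogeneousComponent D (slater (ofRowExponents (b J))) =
        slater (ofRowExponents (b J)) := fun J =>
      MvPolynomial.homogeneousComponent_eq_self (by
        rw [← hbdeg J]; exact slater_isHomogeneous _)
    simp only [h1]
    -- Different subsets give different sets of exponents, so the coefficients at the defining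
    -- monomials form a dual family.
    refine LinearIndependent.of_pairwise_dual_eq_zero_one _
      (fun J => MvPolynomial.lcoeff ℝ (ofRowExponents (b J))) ?_ ?_
    · intro J J' hne
      exact (coeff_slater_ofRowExponents (hb J')).1 (hrne J' J hne.symm)
    · intro J
      exact (coeff_slater_ofRowExponents (b' := b J) (hb J)).2
  have := card_le_spanFinrank (MvPolynomial.homogeneousComponent D) hπ
    (fun J : ι => slater (ofRowExponents (b J))) (fun J => slater_mem_alternants _) hli
  rwa [Fintype.card_coe, Finset.card_powersetCard, hΛc] at this

theorem choose_choose_le_spanFinrank {r j : ℕ} (hn : 1 ≤ n) (hd : 1 ≤ d)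
    (h : n = r.choose d + j) (hj : j < r.choose (d - 1)) :
    (r.choose (d - 1)).choose j ≤ (alternants n d).spanFinrank := by
  -- For `r < d` the hypotheses leave only `n = 0`.
  have hr : d ≤ r := by
    by_contra hlt
    rw [Nat.choose_eq_zero_of_lt (by omega)] at h
    rcases (show r < d - 1 ∨ r = d - 1 by omega) with h1 | h1
    · rw [Nat.choose_eq_zero_of_lt h1] at hj; omega
    · rw [h1, Nat.choose_self] at hj; omega
  obtain ⟨s, rfl⟩ : ∃ s, r = s + d := ⟨r - d, by omega⟩
  exact choose_le_spanFinrank hd h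

end LowerBound

/-! ### Polynomial approximation together with derivatives -/

section Approximation

open MeasureTheory Filter Topology

section Convolution

variable {E : Type} [NormedAddCommGroup E] [NormedSpace ℝ E] [FiniteDimensional ℝ E]
  [MeasurableSpace E] [BorelSpace E] (μ : Measure E) [μ.IsAddHaarMeasure]

/-- The normalized powers `c ^ m / ∫_s c ^ m`. -/
noncomputable def powKernel (c : E → ℝ) (s : Set E) (m : ℕ) (t : E) : ℝ :=
  (∫ x in s, c x ^ m ∂μ)⁻¹ * c t ^ m

variable {c : E → ℝ} {s V T : Set E}

/-- Powers of a function with a unique maximum at 0 concentrate there. The kernel need not be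
truncated to `s`, since `g (x - t)` vanishes for `t` outside `s`. -/
theorem eventually_norm_convolution_powKernel_sub_lt {F : Type} [NormedAddCommGroup F]
    [NormedSpace ℝ F] [CompleteSpace F]
    (hs : IsCompact s) (hs0 : s ∈ 𝓝 (0 : E)) (hc : Continuous c)
    (hmax : ∀ y ∈ s, y ≠ 0 → c y < c 0) (hnn : ∀ x ∈ s, 0 ≤ c x) (hc0 : 0 < c 0)
    (hV : IsCompact V) {g : E → F} (hg : Continuous g) (hgs : ∀ x ∈ V, ∀ t ∉ s, g (x - t) = 0)
    {ε : ℝ} (hε : 0 < ε) :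
    ∀ᶠ m in atTop, ∀ x ∈ V,
      ‖convolution (powKernel μ c s m) g (ContinuousLinearMap.lsmul ℝ ℝ) μ x - g x‖ < ε := by
  have : CompactSpace V := isCompact_iff_compactSpace.1 hV
  -- Regarding the translates of `g` as points of `C(V, F)` makes the convergence uniform in `x ∈
  -- V`.
  let G : C(E, C(V, F)) := ContinuousMap.curry ⟨fun p : E × V => g (p.2 - p.1), by fun_prop⟩
  have hG : ∀ t (x : V), G t x = g (x - t) := fun t x => rfl
  have h := tendsto_setIntegral_pow_smul_of_unique_maximum_of_isCompact_of_continuousOn (μ := μ) hs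
    hc.continuousOn hmax hnn hc0 (subset_closure (mem_interior_iff_mem_nhds.2 hs0))
    G.continuous.continuousOn
  rw [Metric.tendsto_nhds] at h
  filter_upwards [h ε hε] with m hm x hx
  rw [dist_eq_norm] at hm
  refine lt_of_le_of_lt ?_ hm
  have hint : IntegrableOn (fun t => c t ^ m • G t) s μ :=
    ((hc.pow m).smul G.continuous).continuousOn.integrableOn_compact hs
  refine le_trans (le_of_eq ?_) (ContinuousMap.norm_coe_le_norm _ (⟨x, hx⟩ : V))
  congr 1
  rw [ContinuousMap.sub_apply, ContinuousMap.smul_apply, ContinuousMap.integral_apply hint, hG,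
    sub_zero]
  congr 1
  rw [convolution_def, ← setIntegral_eq_integral_of_forall_compl_eq_zero (s := s)]
  · rw [← integral_smul]
    refine integral_congr_ae (ae_of_all _ fun t => ?_)
    simp only [ContinuousLinearMap.lsmul_apply, powKernel, ContinuousMap.smul_apply, hG, mul_smul]
  · intro t ht
    rw [hgs x hx t ht, map_zero]

/-- Derivatives of the convolution fall on `g`. The target space is quantified inside the induction
because the step passes from `g` to `fderiv ℝ g`. -/
theorem eventually_norm_iteratedFDeriv_convolution_powKernel_sub_lt
    (hs : IsCompact s) (hs0 : s ∈ 𝓝 (0 : E)) (hc : Continuous c)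
    (hmax : ∀ y ∈ s, y ≠ 0 → c y < c 0) (hnn : ∀ x ∈ s, 0 ≤ c x) (hc0 : 0 < c 0)
    (hV : IsCompact V) (hT : IsCompact T) (hVT : ∀ x ∈ V, ∀ t ∉ s, x - t ∉ T) (j : ℕ) :
    ∀ {F : Type} [NormedAddCommGroup F] [NormedSpace ℝ F] [CompleteSpace F] {g : E → F},
      ContDiff ℝ j g → tsupport g ⊆ T → ∀ {ε : ℝ}, 0 < ε →
      ∀ᶠ m in atTop, ∀ x ∈ V,
        ‖iteratedFDeriv ℝ j (fun y =>
          convolution (powKernel μ c s m) g (ContinuousLinearMap.lsmul ℝ ℝ) μ y - g y) x‖ < ε := by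
  induction j with
  | zero =>
    intro F _ _ _ g hg hgT ε hε
    simp only [norm_iteratedFDeriv_zero]
    refine eventually_norm_convolution_powKernel_sub_lt μ hs hs0 hc hmax hnn hc0 hV hg.continuous
      (fun x hx t ht => ?_) hε
    by_contra hne
    exact hVT x hx t ht (hgT (subset_tsupport g hne))
  | succ j ih =>
    intro F _ _ _ g hg hgT ε hε
    have hgc : HasCompactSupport g := hT.of_isClosed_subset (isClosed_tsupport g) hgT
    have hg1 : ContDiff ℝ 1 g := hg.of_le (by exact_mod_cast Nat.succ_le_succ (Nat.zero_le j))
    have hg' : ContDiff ℝ j (fderiv ℝ g) := hg.fderiv_right (by norm_cast)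
    filter_upwards [ih hg' ((tsupport_fderiv_subset ℝ).trans hgT) hε] with m hm x hx
    have hK : LocallyIntegrable (powKernel μ c s m) μ :=
      (continuous_const.mul (hc.pow m)).locallyIntegrable
    refine lt_of_eq_of_lt ?_ (hm x hx)
    rw [← norm_iteratedFDeriv_fderiv]
    congr 2
    funext y
    have h1 := hgc.hasFDerivAt_convolution_right (ContinuousLinearMap.lsmul ℝ ℝ) hK hg1 y
    rw [(h1.fun_sub (hg1.differentiable one_ne_zero y).hasFDerivAt).fderiv]
    rfl

end Convolution

variable {n d : ℕ}

/-- Integrating a polynomial in `x` and `y` against a function of `y` gives a polynomial in `x`. -/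
theorem exists_evalAt_eq_integral (P : MvPolynomial ((Fin n × Fin d) ⊕ (Fin n × Fin d)) ℝ)
    (g : (Fin n → Fin d → ℝ) → ℝ) (hg : Continuous g) (hgc : HasCompactSupport g) :
    ∃ p : PolyRing n d, ∀ x, evalAt x p =
      ∫ y, MvPolynomial.eval (Sum.elim (fun v => x v.1 v.2) (fun v => y v.1 v.2)) P * g y := by
  have hcont : ∀ (P : MvPolynomial ((Fin n × Fin d) ⊕ (Fin n × Fin d)) ℝ)
      (x : Fin n → Fin d → ℝ), Continuous fun y : Fin n → Fin d → ℝ =>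
        MvPolynomial.eval (Sum.elim (fun v => x v.1 v.2) (fun v => y v.1 v.2)) P := by
    intro P x
    refine (MvPolynomial.continuous_eval P).comp (continuous_pi fun v => ?_)
    rcases v with v | v
    · exact continuous_const
    · exact (continuous_apply v.2).comp (continuous_apply v.1)
  induction P using MvPolynomial.induction_on generalizing g with
  | C a =>
    refine ⟨MvPolynomial.C (∫ y, a * g y), fun x => ?_⟩
    simp [evalAt]
  | add P Q hP hQ =>
    obtain ⟨p, hp⟩ := hP g hg hgc
    obtain ⟨q, hq⟩ := hQ g hg hgc
    refine ⟨p + q, fun x => ?_⟩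
    have h1 : evalAt x (p + q) = evalAt x p + evalAt x q := map_add _ _ _
    rw [h1, hp, hq, ← integral_add]
    · simp only [map_add, add_mul]
    · exact ((hcont P x).mul hg).integrable_of_hasCompactSupport hgc.mul_left
    · exact ((hcont Q x).mul hg).integrable_of_hasCompactSupport hgc.mul_left
  | mul_X P v hP =>
    rcases v with v | v
    · obtain ⟨p, hp⟩ := hP g hg hgc
      refine ⟨p * MvPolynomial.X v, fun x => ?_⟩
      have h1 : evalAt x (p * MvPolynomial.X v) = evalAt x p * x v.1 v.2 := by simp [evalAt]
      rw [h1, hp, ← integral_mul_const]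
      congr 1
      funext y
      simp only [map_mul, MvPolynomial.eval_X, Sum.elim_inl]
      ring
    -- A factor in the integration variable is absorbed into the weight, hence the induction
    -- generalizes `g`.
    · obtain ⟨p, hp⟩ := hP (fun y => y v.1 v.2 * g y)
        (by fun_prop) hgc.mul_left
      refine ⟨p, fun x => ?_⟩
      rw [hp]
      congr 1
      funext y
      simp only [map_mul, MvPolynomial.eval_X, Sum.elim_inr]
      ring

theorem contDiff_evalAt (p : PolyRing n d) {k : WithTop ℕ∞} :
    ContDiff ℝ k fun x : Fin n → Fin d → ℝ => evalAt x p := by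
  induction p using MvPolynomial.induction_on with
  | C a => simpa [evalAt] using contDiff_const
  | add p q hp hq => simpa [evalAt] using hp.add hq
  | mul_X p v hp =>
    have h1 : ContDiff ℝ k fun x : Fin n → Fin d → ℝ => x v.1 v.2 := by fun_prop
    simpa [evalAt] using hp.mul h1

theorem exists_smooth_cutoff {E : Type*} [NormedAddCommGroup E] [NormedSpace ℝ E]
    [FiniteDimensional ℝ E] {V U : Set E} (hV : IsCompact V) (hU : IsOpen U) (hVU : V ⊆ U) {k : ℕ}
    {F : Type*} [NormedAddCommGroup F] [NormedSpace ℝ F] {f : E → F} (hf : ContDiffOn ℝ k f U) :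
    ∃ g : E → F, ContDiff ℝ k g ∧ HasCompactSupport g ∧ ∀ x ∈ V, g =ᶠ[𝓝 x] f := by
  obtain ⟨t, ht, hVt, htU⟩ := exists_compact_between hV hU hVU
  obtain ⟨χ, h1, h0, -⟩ := exists_contMDiffMap_one_nhds_of_subset_interior (n := (k : ℕ∞))
    (modelWithCornersSelf ℝ E) hV.isClosed hVt
  have hχ : ContDiff ℝ k χ := χ.contMDiff.contDiff
  refine ⟨fun x => χ x • f x, ?_, ?_, ?_⟩
  · rw [contDiff_iff_contDiffAt]
    intro x
    by_cases hx : x ∈ U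
    · exact hχ.contDiffAt.smul (hf.contDiffAt (hU.mem_nhds hx))
    · have hxt : tᶜ ∈ 𝓝 x := ht.isClosed.isOpen_compl.mem_nhds fun h => hx (htU h)
      refine (contDiffAt_const (c := (0 : F))).congr_of_eventuallyEq ?_
      filter_upwards [hxt] with y hy
      rw [h0 y hy, zero_smul]
  · refine HasCompactSupport.intro ht fun x hx => ?_
    rw [h0 x hx, zero_smul]
  · intro x hx
    have := (eventually_nhdsSet_iff_forall.1 h1) x hx
    filter_upwards [this] with y hy
    rw [hy, one_smul]

/-- Weierstrass approximation in the `C^k` sense. -/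
theorem exists_polynomial_iteratedFDeriv_sub_lt {V U : Set (Fin n → Fin d → ℝ)} (hV : IsCompact V)
    (hU : IsOpen U) (hVU : V ⊆ U) {k : ℕ} {f : (Fin n → Fin d → ℝ) → ℝ}
    (hf : ContDiffOn ℝ k f U) {ε : ℝ} (hε : 0 < ε) :
    ∃ p : PolyRing n d, ∀ j ≤ k, ∀ x ∈ V,
      ‖iteratedFDeriv ℝ j (fun y => f y - evalAt y p) x‖ < ε := by
  obtain ⟨g, hg, hgc, hgf⟩ := exists_smooth_cutoff hV hU hVU hf
  obtain ⟨R, hR, hVR⟩ : ∃ R : ℝ, 0 < R ∧ ∀ x ∈ V, ∀ t ∉ Metric.closedBall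
      (0 : Fin n → Fin d → ℝ) R, x - t ∉ tsupport g := by
    obtain ⟨A, hA⟩ := hV.isBounded.exists_norm_le
    obtain ⟨B, hB⟩ := hgc.isCompact.isBounded.exists_norm_le
    refine ⟨max 1 (A + B), by positivity, fun x hx t ht hxt => ht ?_⟩
    rw [mem_closedBall_zero_iff]
    calc ‖t‖ = ‖x - (x - t)‖ := by congr 1; abel
      _ ≤ ‖x‖ + ‖x - t‖ := norm_sub_le _ _
      _ ≤ A + B := add_le_add (hA x hx) (hB _ hxt)
      _ ≤ _ := le_max_right _ _
  set s := Metric.closedBall (0 : Fin n → Fin d → ℝ) R with hs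
  -- On the ball the sum of the `n * d` squares is at most `n * d * R ^ 2`, so `c` is nonnegative
  -- there; the `+ 1` keeps the inverted number positive when `n * d = 0`.
  set κ : ℝ := ((n * d + 1) * R ^ 2)⁻¹ with hκ
  have hκ0 : 0 < κ := by positivity
  let c : (Fin n → Fin d → ℝ) → ℝ := fun y => 1 - κ * ∑ v : Fin n × Fin d, y v.1 v.2 ^ 2
  have hc : Continuous c := by fun_prop
  have hc0 : c 0 = 1 := by simp [c]
  have hmax : ∀ y ∈ s, y ≠ 0 → c y < c 0 := by
    intro y _ hy
    rw [hc0]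
    have : 0 < ∑ v : Fin n × Fin d, y v.1 v.2 ^ 2 := by
      obtain ⟨i, hi⟩ := Function.ne_iff.1 hy
      obtain ⟨j, hj⟩ := Function.ne_iff.1 hi
      refine Finset.sum_pos' (fun v _ => sq_nonneg _) ⟨(i, j), Finset.mem_univ _, ?_⟩
      exact sq_pos_iff.2 hj
    have := mul_pos hκ0 this
    simp only [c]; linarith
  have hnn : ∀ y ∈ s, 0 ≤ c y := by
    intro y hy
    rw [hs, mem_closedBall_zero_iff] at hy
    have h1 : ∑ v : Fin n × Fin d, y v.1 v.2 ^ 2 ≤ (n * d + 1) * R ^ 2 := by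
      calc ∑ v : Fin n × Fin d, y v.1 v.2 ^ 2 ≤ ∑ _v : Fin n × Fin d, R ^ 2 := by
            refine Finset.sum_le_sum fun v _ => ?_
            have h2 : ‖y v.1 v.2‖ ≤ R := ((norm_le_pi_norm _ _).trans (norm_le_pi_norm _ _)).trans hy
            rw [Real.norm_eq_abs] at h2
            rw [← sq_abs]
            gcongr
        _ = (n * d) * R ^ 2 := by simp
        _ ≤ _ := by gcongr; linarith
    have h3 := mul_le_mul_of_nonneg_left h1 hκ0.le
    rw [hκ, inv_mul_cancel₀ (by positivity)] at h3
    simp only [c]; linarith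
  have hev : ∀ᶠ m in atTop, ∀ j ∈ Finset.range (k + 1), ∀ x ∈ V,
      ‖iteratedFDeriv ℝ j (fun y =>
        convolution (powKernel volume c s m) g (ContinuousLinearMap.lsmul ℝ ℝ) volume y - g y) x‖
        < ε := by
    rw [eventually_all_finset]
    intro j hj
    refine eventually_norm_iteratedFDeriv_convolution_powKernel_sub_lt volume
      (isCompact_closedBall _ _) (Metric.closedBall_mem_nhds _ hR) hc hmax hnn (by simp [hc0]) hV
      hgc.isCompact hVR j (hg.of_le ?_) le_rfl hε
    exact_mod_cast Nat.lt_succ_iff.1 (Finset.mem_range.1 hj)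
  obtain ⟨m, hm⟩ := hev.exists
  -- The kernel at `x - y`, as a polynomial in both variables.
  let P : MvPolynomial ((Fin n × Fin d) ⊕ (Fin n × Fin d)) ℝ :=
    MvPolynomial.C (∫ x in s, c x ^ m)⁻¹ * (1 - MvPolynomial.C κ *
      ∑ v : Fin n × Fin d, (MvPolynomial.X (Sum.inl v) - MvPolynomial.X (Sum.inr v)) ^ 2) ^ m
  obtain ⟨p, hp⟩ := exists_evalAt_eq_integral P g hg.continuous hgc
  have hconv : ∀ x, convolution (powKernel volume c s m) g (ContinuousLinearMap.lsmul ℝ ℝ) volume x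
      = evalAt x p := by
    intro x
    rw [hp, convolution_eq_swap]
    congr 1
    funext y
    simp [P, powKernel, c]
  refine ⟨p, fun j hj x hx => ?_⟩
  have h := hm j (Finset.mem_range.2 (by omega)) x hx
  have h1 : (fun y => f y - evalAt y p) =ᶠ[𝓝 x] fun y =>
      -(convolution (powKernel volume c s m) g (ContinuousLinearMap.lsmul ℝ ℝ) volume y - g y) := by
    filter_upwards [hgf x hx] with y hy
    rw [hconv, hy]; ring
  rw [(h1.iteratedFDeriv ℝ j).eq_of_nhds]
  have h2 := iteratedFDeriv_neg_apply (𝕜 := ℝ) (i := j) (x := x) (f := fun y =>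
      convolution (powKernel volume c s m) g (ContinuousLinearMap.lsmul ℝ ℝ) volume y - g y)
  rw [show (fun y => -(convolution (powKernel volume c s m) g (ContinuousLinearMap.lsmul ℝ ℝ)
    volume y - g y)) = -(fun y => convolution (powKernel volume c s m) g
      (ContinuousLinearMap.lsmul ℝ ℝ) volume y - g y) from rfl, h2, norm_neg]
  exact h

end Approximation

/-! ### Bounds for partial derivatives and the antisymmetric part of a function -/

section Derivatives

open Filter Topology

variable {n d : ℕ}

/-- `H` has the smoothness and the bounds of an `m`-th partial derivative of the `C^k` function
`h` on `U`. -/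
def IsDerivBounded (h : (Fin n → Fin d → ℝ) → ℝ) (U : Set (Fin n → Fin d → ℝ)) (k m : ℕ)
    (H : (Fin n → Fin d → ℝ) → ℝ) : Prop :=
  ContDiffOn ℝ (k - m : ℕ) H U ∧
    ∀ x ∈ U, ∀ j, j + m ≤ k → ‖iteratedFDeriv ℝ j H x‖ ≤ ‖iteratedFDeriv ℝ (j + m) h x‖

theorem IsDerivBounded.partialD {h H : (Fin n → Fin d → ℝ) → ℝ} {U : Set (Fin n → Fin d → ℝ)}
    {k m : ℕ} (hU : IsOpen U) (hH : IsDerivBounded h U k m H) (hm : m + 1 ≤ k)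
    (v : Fin n × Fin d) : IsDerivBounded h U k (m + 1) (partialD v H) := by
  set e : Fin n → Fin d → ℝ := Pi.single v.1 (Pi.single v.2 1) with he
  have hnorm : ‖e‖ = 1 := by rw [he, Pi.norm_single, Pi.norm_single, norm_one]
  have hat : ∀ x ∈ U, ContDiffAt ℝ (k - m : ℕ) H x := fun x hx => hH.1.contDiffAt (hU.mem_nhds hx)
  have hfd : ∀ x ∈ U, ContDiffAt ℝ (k - (m + 1) : ℕ) (fderiv ℝ H) x := fun x hx =>
    (hat x hx).fderiv_right (by norm_cast; omega)
  let L : ((Fin n → Fin d → ℝ) →L[ℝ] ℝ) →L[ℝ] ℝ := ContinuousLinearMap.apply ℝ ℝ e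
  -- Coordinate vectors have sup norm 1, so each partial derivative costs no constant.
  have hL : ‖L‖ ≤ 1 := by
    refine ContinuousLinearMap.opNorm_le_bound _ zero_le_one fun f => ?_
    have := f.le_opNorm e
    rw [hnorm, mul_one] at this
    rwa [one_mul]
  have heq : ∀ x ∈ U, _root_.partialD v H =ᶠ[𝓝 x] L ∘ fderiv ℝ H := by
    intro x hx
    filter_upwards [hU.mem_nhds hx] with y hy
    have h1 : DifferentiableAt ℝ H y := (hat y hy).differentiableAt (by norm_cast; omega)
    exact h1.lineDeriv_eq_fderiv
  constructor
  · intro x hx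
    refine ContDiffAt.contDiffWithinAt ?_
    exact (L.contDiff.contDiffAt.comp x (hfd x hx)).congr_of_eventuallyEq (heq x hx)
  · intro x hx j hj
    rw [((heq x hx).iteratedFDeriv ℝ j).eq_of_nhds]
    have h1 := L.norm_iteratedFDeriv_comp_left (hfd x hx) (n := j) (by norm_cast; omega)
    refine h1.trans ?_
    rw [norm_iteratedFDeriv_fderiv]
    calc ‖L‖ * ‖iteratedFDeriv ℝ (j + 1) H x‖ ≤ 1 * ‖iteratedFDeriv ℝ (j + 1) H x‖ := by gcongr
      _ = ‖iteratedFDeriv ℝ (j + 1) H x‖ := one_mul _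
      _ ≤ ‖iteratedFDeriv ℝ (j + 1 + m) h x‖ := hH.2 x hx (j + 1) (by omega)
      _ = ‖iteratedFDeriv ℝ (j + (m + 1)) h x‖ := by
        rw [show j + 1 + m = j + (m + 1) by omega]

theorem IsDerivBounded.iterate_partialD {h H : (Fin n → Fin d → ℝ) → ℝ}
    {U : Set (Fin n → Fin d → ℝ)} {k m : ℕ} (hU : IsOpen U) (hH : IsDerivBounded h U k m H)
    (v : Fin n × Fin d) (a : ℕ) (hm : m + a ≤ k) :
    IsDerivBounded h U k (m + a) ((_root_.partialD v)^[a] H) := by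
  induction a with
  | zero => exact hH
  | succ a ih =>
    rw [Function.iterate_succ_apply']
    exact (ih (by omega)).partialD hU (by omega) v

theorem isDerivBounded_multiD {h : (Fin n → Fin d → ℝ) → ℝ} {U : Set (Fin n → Fin d → ℝ)} {k : ℕ}
    (hU : IsOpen U) (hh : ContDiffOn ℝ k h U) (α : Fin n × Fin d → ℕ) (hα : ∑ v, α v ≤ k) :
    IsDerivBounded h U k (∑ v, α v) (multiD α h) := by
  have key : ∀ l : List (Fin n × Fin d), (l.map α).sum ≤ k →
      IsDerivBounded h U k (l.map α).sum (l.foldr (fun v h => (partialD v)^[α v] h) h) := by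
    intro l
    induction l with
    | nil => exact fun _ => ⟨hh, fun x _ j _ => le_rfl⟩
    | cons v l ih =>
      intro hl
      rw [List.map_cons, List.sum_cons] at hl ⊢
      rw [List.foldr_cons, add_comm]
      exact (ih (by omega)).iterate_partialD hU v _ (by omega)
  have hsum : ((List.finRange n ×ˢ List.finRange d).map α).sum = ∑ v, α v := by
    rw [← List.sum_toFinset α ((List.nodup_finRange n).product (List.nodup_finRange d))]
    congr 1
    ext v
    exact iff_of_true (List.mem_toFinset.2 (List.mem_product.2
      ⟨List.mem_finRange _, List.mem_finRange _⟩)) (Finset.mem_univ v)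
  rw [← hsum] at hα ⊢
  exact key _ hα

theorem ckNorm_le {h : (Fin n → Fin d → ℝ) → ℝ} {U V : Set (Fin n → Fin d → ℝ)} {k : ℕ}
    (hU : IsOpen U) (hVU : V ⊆ U) (hh : ContDiffOn ℝ k h U) {δ : ℝ} (hδ : 0 ≤ δ)
    (hV : ∀ j ≤ k, ∀ x ∈ V, ‖iteratedFDeriv ℝ j h x‖ ≤ δ) :
    ckNorm k V h ≤ (∑ m ∈ Finset.range (k + 1),
      (Finset.piAntidiag (Finset.univ : Finset (Fin n × Fin d)) m).card : ℕ) * δ := by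
  rw [ckNorm, Nat.cast_sum, Finset.sum_mul]
  refine Finset.sum_le_sum fun m hm => ?_
  rw [← nsmul_eq_mul]
  refine Finset.sum_le_card_nsmul _ _ _ fun α hα => ?_
  rw [Finset.mem_piAntidiag] at hα
  have hmk : m ≤ k := Nat.lt_succ_iff.1 (Finset.mem_range.1 hm)
  refine Real.sSup_le ?_ hδ
  rintro _ ⟨x, hx, rfl⟩
  have h1 := (isDerivBounded_multiD hU hh α (hα.1.trans_le hmk)).2 x (hVU hx) 0
    (by rw [zero_add]; exact hα.1.trans_le hmk)
  rw [norm_iteratedFDeriv_zero, zero_add, Real.norm_eq_abs] at h1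
  exact h1.trans (hV _ (hα.1.trans_le hmk) x hx)

/-- Permutation of the points `x₁, …, xₙ`, as an isometry. -/
def permIsometry (n d : ℕ) (σ : Equiv.Perm (Fin n)) :
    (Fin n → Fin d → ℝ) ≃ₗᵢ[ℝ] (Fin n → Fin d → ℝ) where
  toLinearEquiv := LinearEquiv.funCongrLeft ℝ (Fin d → ℝ) σ
  norm_map' x := by
    refine le_antisymm ?_ ?_
    · refine (pi_norm_le_iff_of_nonneg (norm_nonneg x)).2 fun i => norm_le_pi_norm x (σ i)
    · refine (pi_norm_le_iff_of_nonneg (norm_nonneg _)).2 fun i => ?_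
      have := norm_le_pi_norm (LinearEquiv.funCongrLeft ℝ (Fin d → ℝ) σ x) (σ.symm i)
      simpa [LinearEquiv.funCongrLeft_apply, LinearMap.funLeft_apply] using this

theorem permIsometry_apply (σ : Equiv.Perm (Fin n)) (x : Fin n → Fin d → ℝ) :
    permIsometry n d σ x = fun i => x (σ i) := rfl

/-- The antisymmetric part of a function. -/
noncomputable def antisymmetricPart (f : (Fin n → Fin d → ℝ) → ℝ) : (Fin n → Fin d → ℝ) → ℝ :=
  fun x => ∑ σ : Equiv.Perm (Fin n),
    ((n.factorial : ℝ)⁻¹ * (((Equiv.Perm.sign σ : ℤˣ) : ℤ) : ℝ)) • (f ∘ permIsometry n d σ) x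

theorem antisymmetricPart_eq {f : (Fin n → Fin d → ℝ) → ℝ} {S : Set (Fin n → Fin d → ℝ)}
    (hf : AntisymmetricOn f S) {x : Fin n → Fin d → ℝ} (hx : x ∈ S) :
    antisymmetricPart f x = f x := by
  have h1 : ∀ σ : Equiv.Perm (Fin n), ((n.factorial : ℝ)⁻¹ *
      (((Equiv.Perm.sign σ : ℤˣ) : ℤ) : ℝ)) • (f ∘ permIsometry n d σ) x =
        (n.factorial : ℝ)⁻¹ * f x := by
    intro σ
    rw [Function.comp_apply, permIsometry_apply, hf σ x hx, smul_eq_mul, mul_assoc,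
      ← mul_assoc _ _ (f x), sign_mul_sign_self, one_mul]
  rw [antisymmetricPart, Finset.sum_congr rfl fun σ _ => h1 σ, Finset.sum_const, Finset.card_univ,
    Fintype.card_perm, Fintype.card_fin, nsmul_eq_mul, ← mul_assoc, mul_inv_cancel₀ (by positivity),
    one_mul]

theorem antisymmetricPart_sub_evalAt (f : (Fin n → Fin d → ℝ) → ℝ) (p : PolyRing n d) :
    antisymmetricPart (fun x => f x - evalAt x p) = fun x =>
      antisymmetricPart f x - evalAt x ((n.factorial : ℝ)⁻¹ • antisymmetrize n d p) := by
  funext x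
  have h1 : evalAt x ((n.factorial : ℝ)⁻¹ • antisymmetrize n d p) =
      ∑ σ : Equiv.Perm (Fin n), ((n.factorial : ℝ)⁻¹ * (((Equiv.Perm.sign σ : ℤˣ) : ℤ) : ℝ)) *
        evalAt (permIsometry n d σ x) p := by
    simp only [permIsometry_apply, ← evalAt_permPoly]
    rw [antisymmetrize_apply]
    simp only [evalAt, MvPolynomial.smul_eval, map_sum, map_mul, map_intCast, Finset.mul_sum,
      mul_assoc]
  rw [h1, antisymmetricPart, antisymmetricPart, ← Finset.sum_sub_distrib]
  refine Finset.sum_congr rfl fun σ _ => ?_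
  simp only [Function.comp_apply, smul_eq_mul, mul_sub]

theorem contDiffAt_antisymmetricPart {f : (Fin n → Fin d → ℝ) → ℝ} {k : ℕ}
    {x : Fin n → Fin d → ℝ} (hf : ∀ σ, ContDiffAt ℝ k f (permIsometry n d σ x)) :
    ContDiffAt ℝ k (antisymmetricPart f) x :=
  ContDiffAt.sum fun σ _ => ((hf σ).comp x
    (permIsometry n d σ).toContinuousLinearEquiv.contDiff.contDiffAt).const_smul _

/-- A signed average over linear isometries preserves a bound valid on the whole orbit. -/
theorem norm_iteratedFDeriv_antisymmetricPart_le {f : (Fin n → Fin d → ℝ) → ℝ} {j : ℕ}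
    {x : Fin n → Fin d → ℝ} (hf : ∀ σ, ContDiffAt ℝ j f (permIsometry n d σ x)) {δ : ℝ}
    (hδ : ∀ σ, ‖iteratedFDeriv ℝ j f (permIsometry n d σ x)‖ ≤ δ) :
    ‖iteratedFDeriv ℝ j (antisymmetricPart f) x‖ ≤ δ := by
  have hc : ∀ σ : Equiv.Perm (Fin n), ContDiffAt ℝ j (f ∘ permIsometry n d σ) x := fun σ =>
    (hf σ).comp x (permIsometry n d σ).toContinuousLinearEquiv.contDiff.contDiffAt
  have h1 : iteratedFDeriv ℝ j (antisymmetricPart f) x = ∑ σ : Equiv.Perm (Fin n),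
      ((n.factorial : ℝ)⁻¹ * (((Equiv.Perm.sign σ : ℤˣ) : ℤ) : ℝ)) •
        iteratedFDeriv ℝ j (f ∘ permIsometry n d σ) x := by
    have h2 := iteratedFDeriv_fun_sum_apply (𝕜 := ℝ) (n := j) (x := x) (u := Finset.univ)
      (f := fun (σ : Equiv.Perm (Fin n)) x =>
        ((n.factorial : ℝ)⁻¹ * (((Equiv.Perm.sign σ : ℤˣ) : ℤ) : ℝ)) •
          (f ∘ permIsometry n d σ) x) (fun σ _ => (hc σ).const_smul _)
    refine h2.trans (Finset.sum_congr rfl fun σ _ => ?_)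
    exact iteratedFDeriv_const_smul_apply' (𝕜 := ℝ) (hc σ)
  rw [h1]
  have hbound : ∀ σ : Equiv.Perm (Fin n), ‖((n.factorial : ℝ)⁻¹ *
      (((Equiv.Perm.sign σ : ℤˣ) : ℤ) : ℝ)) • iteratedFDeriv ℝ j (f ∘ permIsometry n d σ) x‖ ≤
        (n.factorial : ℝ)⁻¹ * δ := by
    intro σ
    rw [norm_smul, (permIsometry n d σ).norm_iteratedFDeriv_comp_right, norm_mul]
    have h3 : ‖(((Equiv.Perm.sign σ : ℤˣ) : ℤ) : ℝ)‖ = 1 := by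
      rcases Int.units_eq_one_or (Equiv.Perm.sign σ) with h | h <;> simp [h]
    have h4 : ‖(n.factorial : ℝ)⁻¹‖ = (n.factorial : ℝ)⁻¹ := Real.norm_of_nonneg (by positivity)
    rw [h3, h4, mul_one]
    exact mul_le_mul_of_nonneg_left (hδ σ) (by positivity)
  refine (norm_sum_le_of_le _ fun σ _ => hbound σ).trans (le_of_eq ?_)
  rw [Finset.sum_const, Finset.card_univ, Fintype.card_perm, Fintype.card_fin, nsmul_eq_mul,
    ← mul_assoc, mul_inv_cancel₀ (by positivity), one_mul]

theorem permIsometry_mem_cartesianPower {Ω : Set (Fin d → ℝ)} {x : Fin n → Fin d → ℝ}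
    (hx : x ∈ cartesianPower n Ω) (σ : Equiv.Perm (Fin n)) :
    permIsometry n d σ x ∈ cartesianPower n Ω := fun i => hx (σ i)

theorem isCompact_cartesianPower {Ω : Set (Fin d → ℝ)} (hΩ : IsCompact Ω) :
    IsCompact (cartesianPower n Ω) := by
  have : cartesianPower n Ω = Set.pi Set.univ fun _ => Ω := by
    ext x; simp [cartesianPower]
  rw [this]
  exact isCompact_univ_pi fun _ => hΩ

theorem isCkOn_antisymmetricPart {f : (Fin n → Fin d → ℝ) → ℝ} {k : ℕ} {Ω : Set (Fin d → ℝ)}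
    (hf : IsCkOn k (cartesianPower n Ω) f) :
    IsCkOn k (cartesianPower n Ω) (antisymmetricPart f) := by
  obtain ⟨U, hU, hVU, hfU⟩ := hf
  refine ⟨⋂ σ, permIsometry n d σ ⁻¹' U,
    isOpen_iInter_of_finite fun σ => hU.preimage (permIsometry n d σ).continuous,
    fun x hx => Set.mem_iInter.2 fun σ => hVU (permIsometry_mem_cartesianPower hx σ), ?_⟩
  intro x hx
  rw [Set.mem_iInter] at hx
  exact (contDiffAt_antisymmetricPart fun σ =>
    hfU.contDiffAt (hU.mem_nhds (hx σ))).contDiffWithinAt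

theorem cartesianPower_subset_closure_interior {Ω : Set (Fin d → ℝ)}
    (hΩ : Ω ⊆ closure (interior Ω)) :
    cartesianPower n Ω ⊆ closure (interior (cartesianPower n Ω)) := by
  have h1 : ∀ S : Set (Fin d → ℝ), cartesianPower n S = Set.pi Set.univ fun _ => S := fun S => by
    ext x; simp [cartesianPower]
  rw [h1, interior_pi_set Set.finite_univ, closure_pi_set]
  exact Set.pi_mono fun _ _ => hΩ

/-- The derivatives vanish at interior points of `V`, hence by continuity at their limits. -/
theorem iteratedFDeriv_eq_zero_of_eqOn {E F : Type*} [NormedAddCommGroup E] [NormedSpace ℝ E]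
    [NormedAddCommGroup F] [NormedSpace ℝ F] {h : E → F} {V : Set E} {k : ℕ}
    (hV : V ⊆ closure (interior V)) (hh : ∀ x ∈ V, h x = 0) {x : E} (hx : x ∈ V)
    (hd : ContDiffAt ℝ k h x) {j : ℕ} (hj : j ≤ k) : iteratedFDeriv ℝ j h x = 0 := by
  have hcont : ContinuousAt (iteratedFDeriv ℝ j h) x :=
    (hd.iteratedFDeriv_right (m := 0) (i := j) (by simpa using hj)).continuousAt
  have h0 : ∀ y ∈ interior V, iteratedFDeriv ℝ j h y = 0 := by
    intro y hy
    have : h =ᶠ[𝓝 y] fun _ => 0 := by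
      filter_upwards [isOpen_interior.mem_nhds hy] with z hz using hh z (interior_subset hz)
    rw [(this.iteratedFDeriv ℝ j).eq_of_nhds, iteratedFDeriv_fun_zero]
    rfl
  by_contra hne
  obtain ⟨y, hy1, hy2⟩ := mem_closure_iff_nhds.1 (hV hx) _ (hcont.eventually_ne hne)
  exact hy1 (h0 y hy2)

end Derivatives

/-! ### Approximation by alternants and the choice of F -/

section Main

open Filter Topology

variable {n d : ℕ}

/-- If `p` approximates `f`, then `q`, the antisymmetric part of `p`, serves: on `Ω^n` the
derivatives of `F - q` are those of the antisymmetric part of `f - p`. -/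
theorem exists_alternant_ckNorm_sub_lt {k : ℕ} {Ω : Set (Fin d → ℝ)} (hΩ : IsCompact Ω)
    {f F : (Fin n → Fin d → ℝ) → ℝ} (hf : IsCkOn k (cartesianPower n Ω) f)
    (hF : IsCkOn k (cartesianPower n Ω) F)
    (hFf : ∀ j ≤ k, ∀ x ∈ cartesianPower n Ω,
      iteratedFDeriv ℝ j F x = iteratedFDeriv ℝ j (antisymmetricPart f) x)
    {ε : ℝ} (hε : 0 < ε) :
    ∃ q ∈ alternants n d, ckNorm k (cartesianPower n Ω) (fun x => F x - evalAt x q) < ε := by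
  obtain ⟨C, hC⟩ : ∃ C : ℕ, C = ∑ m ∈ Finset.range (k + 1),
      (Finset.piAntidiag (Finset.univ : Finset (Fin n × Fin d)) m).card := ⟨_, rfl⟩
  obtain ⟨U, hU, hVU, hfU⟩ := hf
  obtain ⟨W, hW, hVW, hFW⟩ := hF
  -- `C` counts the multi-indices in the norm; dividing by `C + 1` makes the final inequality
  -- strict.
  have hδ : 0 < ε / (C + 1) := by positivity
  obtain ⟨p, hp⟩ := exists_polynomial_iteratedFDeriv_sub_lt (isCompact_cartesianPower hΩ) hU hVU
    hfU hδ
  set q : PolyRing n d := (n.factorial : ℝ)⁻¹ • antisymmetrize n d p with hq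
  refine ⟨q, Submodule.smul_of_tower_mem (alternants n d) _ (antisymmetrize_mem_alternants p), ?_⟩
  have hfat : ∀ x ∈ cartesianPower n Ω, ContDiffAt ℝ k f x := fun x hx =>
    hfU.contDiffAt (hU.mem_nhds (hVU hx))
  have hbound : ∀ j ≤ k, ∀ x ∈ cartesianPower n Ω,
      ‖iteratedFDeriv ℝ j (fun x => F x - evalAt x q) x‖ ≤ ε / (C + 1) := by
    intro j hj x hx
    have hjk : (j : WithTop ℕ∞) ≤ k := by exact_mod_cast hj
    have h1 : iteratedFDeriv ℝ j (fun x => F x - evalAt x q) x =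
        iteratedFDeriv ℝ j (antisymmetricPart fun x => f x - evalAt x p) x := by
      rw [antisymmetricPart_sub_evalAt,
        fun_iteratedFDeriv_sub_apply ((hFW.contDiffAt (hW.mem_nhds (hVW hx))).of_le hjk)
          (contDiff_evalAt q).contDiffAt,
        fun_iteratedFDeriv_sub_apply ((contDiffAt_antisymmetricPart fun σ =>
          hfat _ (permIsometry_mem_cartesianPower hx σ)).of_le hjk)
          (contDiff_evalAt q).contDiffAt, hFf j hj x hx]
    rw [h1]
    refine norm_iteratedFDeriv_antisymmetricPart_le (fun σ => ?_) fun σ =>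
      (hp j hj _ (permIsometry_mem_cartesianPower hx σ)).le
    exact ((hfat _ (permIsometry_mem_cartesianPower hx σ)).of_le hjk).sub
      (contDiff_evalAt p).contDiffAt
  refine (ckNorm_le hW hVW (hFW.sub (contDiff_evalAt q).contDiffOn) hδ.le hbound).trans_lt ?_
  rw [← hC, mul_div_assoc', div_lt_iff₀ (by positivity)]
  nlinarith

theorem iteratedFDeriv_eq_antisymmetricPart {k : ℕ} {Ω : Set (Fin d → ℝ)}
    {f : (Fin n → Fin d → ℝ) → ℝ} (hf : IsCkOn k (cartesianPower n Ω) f)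
    (hanti : AntisymmetricOn f (cartesianPower n Ω))
    (h : Ω ⊆ closure (interior Ω) ∨ ∃ U : Set (Fin n → Fin d → ℝ),
      IsOpen U ∧ cartesianPower n Ω ⊆ U ∧ AntisymmetricOn f U)
    {j : ℕ} (hj : j ≤ k) {x : Fin n → Fin d → ℝ} (hx : x ∈ cartesianPower n Ω) :
    iteratedFDeriv ℝ j f x = iteratedFDeriv ℝ j (antisymmetricPart f) x := by
  rcases h with h | ⟨U, hU, hVU, hUf⟩
  · obtain ⟨W, hW, hVW, hfW⟩ := hf
    have hfat : ∀ x ∈ cartesianPower n Ω, ContDiffAt ℝ k f x := fun x hx =>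
      hfW.contDiffAt (hW.mem_nhds (hVW hx))
    have hpat : ContDiffAt ℝ k (antisymmetricPart f) x := contDiffAt_antisymmetricPart fun σ =>
      hfat _ (permIsometry_mem_cartesianPower hx σ)
    have hjk : (j : WithTop ℕ∞) ≤ k := by exact_mod_cast hj
    have h0 := iteratedFDeriv_eq_zero_of_eqOn (h := fun y => f y - antisymmetricPart f y)
      (cartesianPower_subset_closure_interior h)
      (fun y hy => by rw [antisymmetricPart_eq hanti hy, sub_self]) hx ((hfat x hx).sub hpat) hj
    rwa [fun_iteratedFDeriv_sub_apply ((hfat x hx).of_le hjk) (hpat.of_le hjk), sub_eq_zero] at h0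
  · have : f =ᶠ[𝓝 x] antisymmetricPart f := by
      filter_upwards [hU.mem_nhds (hVU hx)] with y hy using (antisymmetricPart_eq hUf hy).symm
    exact (this.iteratedFDeriv ℝ j).eq_of_nhds

end Main

theorem mainTheorem4 (n d : ℕ) (hn : 1 ≤ n) (hd : 1 ≤ d) :
    -- the alternants are a finitely generated module over the totally symmetric polynomials
    (alternants n d).FG ∧
    -- `n` is uniquely of the form `C(r, d) + j` with `0 ≤ j < C(r, d - 1)`
    (∃! rj : ℕ × ℕ, n = rj.1.choose d + rj.2 ∧ rj.2 < rj.1.choose (d - 1)) ∧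
    -- lower bound for the minimal number of generators
    (∀ r j : ℕ, n = r.choose d + j → j < r.choose (d - 1) →
      (r.choose (d - 1)).choose j ≤ (alternants n d).spanFinrank) ∧
    -- upper bound for the minimal number of generators
    (alternants n d).spanFinrank ≤ (n.choose 2 + d * n).choose (d * n) ∧
    -- a minimal system of homogeneous generators, fixed before `k`, `Ω`, `f` and `ε`
    ∃ g : Fin (alternants n d).spanFinrank → PolyRing n d,
      (∀ i, g i ∈ alternants n d) ∧
      (∀ i, ∃ m : ℕ, m ≤ n.choose 2 ∧ (g i).IsHomogeneous m) ∧
      Submodule.span (symmetricPolys n d) (Set.range g) = alternants n d ∧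
      ∀ (k : ℕ) (Ω : Set (Fin d → ℝ)), IsCompact Ω →
        ∀ f : (Fin n → Fin d → ℝ) → ℝ,
          IsCkOn k (cartesianPower n Ω) f → AntisymmetricOn f (cartesianPower n Ω) →
          -- `F` has the same values as `f` on `Ω^n`; it is `f` itself as soon as the values of `f`
          -- on `Ω^n` determine its derivatives there, or `f` is antisymmetric near `Ω^n`
          ∃ F : (Fin n → Fin d → ℝ) → ℝ,
            IsCkOn k (cartesianPower n Ω) F ∧
            Set.EqOn F f (cartesianPower n Ω) ∧
            ((Ω ⊆ closure (interior Ω) ∨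
                ∃ U : Set (Fin n → Fin d → ℝ),
                  IsOpen U ∧ cartesianPower n Ω ⊆ U ∧ AntisymmetricOn f U) → F = f) ∧
            ∀ ε : ℝ, 0 < ε →
              ∃ u : Fin (alternants n d).spanFinrank → symmetricPolys n d,
                ckNorm k (cartesianPower n Ω)
                  (fun x => F x - evalAt x (∑ i, (u i : PolyRing n d) * g i)) < ε := by
  obtain ⟨g, hg, hhom, hspan⟩ := exists_minimal_homogeneous_generators n d
  refine ⟨alternants_fg n d, Nat.existsUnique_choose_add d n hd,
    fun r j h hj => choose_choose_le_spanFinrank hn hd h hj, spanFinrank_alternants_le n d,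
    g, hg, hhom, hspan, fun k Ω hΩ f hf hanti => ?_⟩
  have key : ∀ F, IsCkOn k (cartesianPower n Ω) F → (∀ j ≤ k, ∀ x ∈ cartesianPower n Ω,
      iteratedFDeriv ℝ j F x = iteratedFDeriv ℝ j (antisymmetricPart f) x) →
      ∀ ε : ℝ, 0 < ε → ∃ u : Fin (alternants n d).spanFinrank → symmetricPolys n d,
        ckNorm k (cartesianPower n Ω)
          (fun x => F x - evalAt x (∑ i, (u i : PolyRing n d) * g i)) < ε := by
    intro F hF hFf ε hε
    obtain ⟨q, hq, hlt⟩ := exists_alternant_ckNorm_sub_lt hΩ hf hF hFf hε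
    rw [← hspan, Submodule.mem_span_range_iff_exists_fun] at hq
    obtain ⟨u, rfl⟩ := hq
    exact ⟨u, hlt⟩
  -- Either `f` already has the derivatives of its antisymmetric part on `Ω^n`, or `f` is replaced
  -- by that part.
  by_cases h : Ω ⊆ closure (interior Ω) ∨ ∃ U : Set (Fin n → Fin d → ℝ),
      IsOpen U ∧ cartesianPower n Ω ⊆ U ∧ AntisymmetricOn f U
  · exact ⟨f, hf, fun _ _ => rfl, fun _ => rfl,
      key f hf fun j hj x hx => iteratedFDeriv_eq_antisymmetricPart hf hanti h hj hx⟩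
  · exact ⟨antisymmetricPart f, isCkOn_antisymmetricPart hf,
      fun x hx => antisymmetricPart_eq hanti hx, fun h' => absurd h' h,
      key _ (isCkOn_antisymmetricPart hf) fun _ _ _ _ => rfl⟩
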